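/- **Conventions.** Formulas are built from variables $x_0,x_1,\dots$ in the language $\wedge,\vee,\cdot,\to,0,1$ of BL-algebras expanded with a constant $\boldsymbol c_q$ for each rational $q\in[0,1]$. A *logic* is a finitary, substitution invariant consequence relation $\vdash$ on the set $Fm$ of formulas; $\vdash'$ is an *extension* of $\vdash$ if $\Gamma\vdash\varphi$ implies $\Gamma\vdash'\varphi$. A rule $\Gamma\rhd\varphi$ (with $\Gamma$ finite) is *derivable* in $\vdash$ if $\Gamma\vdash\varphi$; *admissible* if for every substitution $\sigma$, $\emptyset\vdash\sigma(\gamma)$ for all $\gamma\in\Gamma$ implies $\emptyset\vdash\sigma(\varphi)$; and *active* if $\emptyset\vdash\sigma(\gamma)$ for all $\gamma\in\Gamma$ holds for some substitution $\sigma$. The logic $\vdash$ is *structurally complete* (SC) if all its admissible rules are derivable, *actively structurally complete* (ASC) if all its active admissible rules are derivable, and *hereditarily structurally complete* (HSC) if all its extensions are SC. A *quasivariety* is a class of algebras axiomatized by quasiequations (implications from a finite, possibly empty, set of equations to an equation), and it is *generated* by $\boldsymbol A$ if it is the smallest quasivariety containing $\boldsymbol A$. A logic $\vdash$ is *algebraized*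 by a quasivariety $\mathsf K$ if there are a finite set $\boldsymbol\tau(x)$ of equations and a finite set $\Delta(x,y)$ of formulas such that, for all $\Gamma\cup\{\varphi\}\subseteq Fm$, $\Gamma\vdash\varphi$ iff $\bigcup_{\gamma\in\Gamma}\boldsymbol\tau(\gamma)\vDash_{\mathsf K}\boldsymbol\tau(\varphi)$, and moreover $x\approx y$ and $\bigcup_{\delta\in\Delta(x,y)}\boldsymbol\tau(\delta)$ are equivalent with respect to $\vDash_{\mathsf K}$, the equational consequence relative to $\mathsf K$. *Gödel algebras* are the members of the variety generated by $[0,1]$ with $\wedge=\cdot=\min$, $\vee=\max$, and $a\to c=1$ if $a\le c$, $a\to c=c$ otherwise. A *rational Gödel algebra* is an algebra whose constant-free reduct is a Gödel algebra and which validates $\boldsymbol c_p\cdot\boldsymbol c_q\approx\boldsymbol c_{\min(p,q)}$, $\boldsymbol c_p\to\boldsymbol c_q\approx\boldsymbol c_{p\to q}$ (with $p\to q$ computed in $[0,1]$), $\boldsymbol c_0\approx0$ and $\boldsymbol c_1\approx1$; it is a *chain* if its lattice order is total. *Rational Gödel logic* $\mathbf{RG}$ is given by $\Gamma\vdash\varphi$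 iff there is a finite $\Gamma_0\subseteq\Gamma$ such that, in every rational Gödel algebra, every assignment giving value $1$ to all members of $\Gamma_0$ gives value $1$ to $\varphi$. For real $r\in(0,1]$, $\boldsymbol Q_r$ is the rational Gödel chain with universe $([0,r)\cap\mathbb Q)\cup\{1\}$, ordered as in $\mathbb Q$. For rational $p\in[0,1)$ and $\gamma\in\omega+1$, $\boldsymbol Q_p^\gamma$ is the rational Gödel chain with universe $([0,p]\cap\mathbb Q)\cup\{t_n:n<\gamma\}\cup\{1\}$, where $[0,p]\cap\mathbb Q$ has its natural order and lies below all $t_n$, $t_n\le t_m$ iff $n\le m$, and $1$ is the greatest element. In both, $\boldsymbol c_q$ is interpreted as $q$ if $q$ belongs to the universe, and as $1$ otherwise. **Theorem.** The following are equivalent for an extension $\vdash$ of $\mathbf{RG}$: 1. $\vdash$ is HSC; 2. $\vdash$ is SC; 3. $\vdash$ is ASC; 4. $\vdash$ is algebraized by a quasivariety $\mathsf K$ generated by a rational Gödel chain $\boldsymbol A$. Furthermore, in condition 4 the chain $\boldsymbol A$ can be chosen (for the same $\mathsf K$) either trivial (one-element), or of the form $\boldsymbol Q_r$ with $r\in(0,1]$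 real, or of the form $\boldsymbol Q_p^\gamma$ with $p\in[0,1)\cap\mathbb Q$ and $\gamma\in\omega+1$. -/

import Mathlib

namespace RatGodel

/-! ### Terms and algebras

The language of BL-algebras expanded with a set `C` of constants; `C = Empty` gives the language
of BL-algebras itself. -/

/-- Terms (propositional formulas) with variables in `α`, in the language of BL-algebras
expanded with constants from `C`. -/
inductive Tm (C α : Type) : Type
  | var : α → Tm C α
  | cst : C → Tm C α
  | inf : Tm C α → Tm C α → Tm C α
  | sup : Tm C α → Tm C α → Tm C α
  | mul : Tm C α → Tm C α → Tm C α
  | imp : Tm C α → Tm C α → Tm C α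
  | zero : Tm C α
  | one : Tm C α

/-- Formulas with the denumerable set of variables `x₀, x₁, …`. -/
abbrev Fm (C : Type) : Type := Tm C ℕ

/-- Algebras of the language. -/
structure Alg (C : Type) : Type 1 where
  carrier : Type
  inf : carrier → carrier → carrier
  sup : carrier → carrier → carrier
  mul : carrier → carrier → carrier
  imp : carrier → carrier → carrier
  zero : carrier
  one : carrier
  cst : C → carrier

/-- Simultaneous substitution of terms for variables. -/
def Tm.subst {C α β : Type} (σ : α → Tm C β) : Tm C α → Tm C β
  | .var x => σ x
  | .cst c => .cst c
  | .inf s t => .inf (s.subst σ) (t.subst σ)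
  | .sup s t => .sup (s.subst σ) (t.subst σ)
  | .mul s t => .mul (s.subst σ) (t.subst σ)
  | .imp s t => .imp (s.subst σ) (t.subst σ)
  | .zero => .zero
  | .one => .one

/-- The value of a term in an algebra under an assignment. -/
def Tm.eval {C α : Type} (A : Alg C) (v : α → A.carrier) : Tm C α → A.carrier
  | .var x => v x
  | .cst c => A.cst c
  | .inf s t => A.inf (s.eval A v) (t.eval A v)
  | .sup s t => A.sup (s.eval A v) (t.eval A v)
  | .mul s t => A.mul (s.eval A v) (t.eval A v)
  | .imp s t => A.imp (s.eval A v) (t.eval A v)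
  | .zero => A.zero
  | .one => A.one

theorem Tm.eval_subst {C α β : Type} (A : Alg C) (v : β → A.carrier) (σ : α → Tm C β)
    (t : Tm C α) : (t.subst σ).eval A v = t.eval A (fun x => (σ x).eval A v) := by
  induction t <;> simp_all [Tm.subst, Tm.eval]

/-- The reduct of an algebra to the language of BL-algebras. -/
def Alg.reduct {C : Type} (A : Alg C) : Alg Empty where
  carrier := A.carrier
  inf := A.inf
  sup := A.sup
  mul := A.mul
  imp := A.imp
  zero := A.zero
  one := A.one
  cst := Empty.elim

/-- The lattice order: `a ≤ b` iff `a ∧ b = a`. -/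
def Alg.le {C : Type} (A : Alg C) (a b : A.carrier) : Prop := A.inf a b = a

/-- An algebra is trivial if it has just one element (the language has constants, so that no
algebra is empty). -/
def Alg.IsTrivial {C : Type} (A : Alg C) : Prop := Subsingleton A.carrier

/-! ### Equations, quasiequations, varieties and quasivarieties -/

/-- An equation `s ≈ t`, as a pair of terms with variables in `α`. -/
abbrev Equation (C α : Type) : Type := Tm C α × Tm C α

/-- `v` solves the equation `e` in `A`. -/
def Alg.Solves {C α : Type} (A : Alg C) (v : α → A.carrier) (e : Equation C α) : Prop :=
  e.1.eval A v = e.2.eval A v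

/-- `A` validates the universally quantified equation `e`. -/
def Alg.Validates {C : Type} (A : Alg C) (e : Equation C ℕ) : Prop :=
  ∀ v : ℕ → A.carrier, A.Solves v e

/-- A quasiequation: a finite (possibly empty) conjunction of equations implies an equation. -/
structure QuasiEquation (C : Type) : Type where
  premises : Set (Equation C ℕ)
  finite_premises : premises.Finite
  conclusion : Equation C ℕ

/-- `A` validates the universally quantified quasiequation `q`. -/
def Alg.ValidatesQ {C : Type} (A : Alg C) (q : QuasiEquation C) : Prop :=
  ∀ v : ℕ → A.carrier, (∀ e ∈ q.premises, A.Solves v e) → A.Solves v q.conclusion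

/-- A variety: a class of algebras axiomatized by equations. -/
def IsVariety {C : Type} (K : Set (Alg C)) : Prop :=
  ∃ E : Set (Equation C ℕ), K = {A | ∀ e ∈ E, A.Validates e}

/-- A quasivariety: a class of algebras axiomatized by quasiequations. -/
def IsQuasivariety {C : Type} (K : Set (Alg C)) : Prop :=
  ∃ E : Set (QuasiEquation C), K = {A | ∀ q ∈ E, A.ValidatesQ q}

/-- The smallest variety that contains `M`. -/
def varietyGen {C : Type} (M : Set (Alg C)) : Set (Alg C) :=
  ⋂₀ {K | IsVariety K ∧ M ⊆ K}

/-- The smallest quasivariety that contains `M`. -/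
def quasivarietyGen {C : Type} (M : Set (Alg C)) : Set (Alg C) :=
  ⋂₀ {K | IsQuasivariety K ∧ M ⊆ K}

/-- Equational consequence relative to `K`. -/
def EqConsequence {C : Type} (K : Set (Alg C)) (Θ : Set (Equation C ℕ)) (e : Equation C ℕ) :
    Prop :=
  ∀ A ∈ K, ∀ v : ℕ → A.carrier, (∀ d ∈ Θ, A.Solves v d) → A.Solves v e

/-! ### Logics and structural completeness -/

/-- A logic: a finitary substitution invariant consequence relation on formulas. -/
structure Logic (C : Type) : Type where
  Entails : Set (Fm C) → Fm C → Prop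
  reflexive : ∀ {Γ : Set (Fm C)} {φ : Fm C}, φ ∈ Γ → Entails Γ φ
  cut : ∀ {Γ Δ : Set (Fm C)} {φ : Fm C}, (∀ ψ ∈ Δ, Entails Γ ψ) → Entails Δ φ → Entails Γ φ
  substitution : ∀ {Γ : Set (Fm C)} {φ : Fm C} (σ : ℕ → Fm C),
    Entails Γ φ → Entails (Tm.subst σ '' Γ) (φ.subst σ)
  finitary : ∀ {Γ : Set (Fm C)} {φ : Fm C}, Entails Γ φ → ∃ Δ ⊆ Γ, Δ.Finite ∧ Entails Δ φ

/-- `L'` is an extension of `L` (in the same language). -/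
def Logic.IsExtensionOf {C : Type} (L' L : Logic C) : Prop :=
  ∀ (Γ : Set (Fm C)) (φ : Fm C), L.Entails Γ φ → L'.Entails Γ φ

/-- Theorems of a logic. -/
def Logic.IsTheorem {C : Type} (L : Logic C) (φ : Fm C) : Prop := L.Entails ∅ φ

/-- The rule `Γ ▷ φ` is admissible in `L`. -/
def Logic.Admissible {C : Type} (L : Logic C) (Γ : Set (Fm C)) (φ : Fm C) : Prop :=
  ∀ σ : ℕ → Fm C, (∀ γ ∈ Γ, L.IsTheorem (γ.subst σ)) → L.IsTheorem (φ.subst σ)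

/-- Rules with premises `Γ` are active in `L`: some substitution turns all premises into
theorems. -/
def Logic.Active {C : Type} (L : Logic C) (Γ : Set (Fm C)) : Prop :=
  ∃ σ : ℕ → Fm C, ∀ γ ∈ Γ, L.IsTheorem (γ.subst σ)

/-- Structural completeness: every admissible rule is derivable. -/
def Logic.SC {C : Type} (L : Logic C) : Prop :=
  ∀ (Γ : Set (Fm C)) (φ : Fm C), Γ.Finite → L.Admissible Γ φ → L.Entails Γ φ

/-- Active structural completeness: every active admissible rule is derivable. -/
def Logic.ASC {C : Type} (L : Logic C) : Prop :=
  ∀ (Γ : Set (Fm C)) (φ : Fm C), Γ.Finite → L.Active Γ → L.Admissible Γ φ → L.Entails Γ φ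

/-- Hereditary structural completeness: every extension is structurally complete. -/
def Logic.HSC {C : Type} (L : Logic C) : Prop :=
  ∀ L' : Logic C, L'.IsExtensionOf L → L'.SC

/-! ### Algebraization -/

/-- `τ(φ)`, for a set `τ(x)` of equations in one variable. -/
def applyEqs {C : Type} (τ : Set (Equation C Unit)) (φ : Fm C) : Set (Equation C ℕ) :=
  {e | ∃ t ∈ τ, e = (t.1.subst (fun _ => φ), t.2.subst (fun _ => φ))}

/-- `Δ(φ, ψ)`, for a set `Δ(x, y)` of formulas in two variables. -/
def applyFms {C : Type} (Δ : Set (Tm C (Fin 2))) (φ ψ : Fm C) : Set (Fm C) :=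
  {χ | ∃ d ∈ Δ, χ = d.subst ![φ, ψ]}

/-- `L` is algebraized by the quasivariety `K` (Blok and Pigozzi). -/
def Logic.AlgebraizedBy {C : Type} (L : Logic C) (K : Set (Alg C)) : Prop :=
  IsQuasivariety K ∧
  ∃ (τ : Set (Equation C Unit)) (Δ : Set (Tm C (Fin 2))), τ.Finite ∧ Δ.Finite ∧
    (∀ (Γ : Set (Fm C)) (φ : Fm C),
      L.Entails Γ φ ↔ ∀ e ∈ applyEqs τ φ, EqConsequence K (⋃ γ ∈ Γ, applyEqs τ γ) e) ∧
    (∀ e ∈ ⋃ δ ∈ applyFms Δ (.var 0) (.var 1), applyEqs τ δ,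
      EqConsequence K {(.var 0, .var 1)} e) ∧
    EqConsequence K (⋃ δ ∈ applyFms Δ (.var 0) (.var 1), applyEqs τ δ) (.var 0, .var 1)

/-! ### Gödel algebras and rational Gödel algebras -/

/-- The Gödel implication of a linear order with greatest element `top`. -/
def godelImp {X : Type} [LinearOrder X] (top a c : X) : X := if a ≤ c then top else c

/-- The algebra of a linear order with least element `bot` and greatest element `top` whose
multiplication is the minimum, with the constants interpreted by `k`. -/
def godelChain {C : Type} (X : Type) [LinearOrder X] (bot top : X) (k : C → X) : Alg C where
  carrier := X
  inf := min
  sup := max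
  mul := min
  imp := godelImp top
  zero := bot
  one := top
  cst := k

/-- The standard Gödel algebra on the real unit interval. -/
noncomputable def standardGodel : Alg Empty :=
  godelChain (Set.Icc (0 : ℝ) 1) 0 1 Empty.elim

/-- The implication of the standard Gödel algebra is the residuum of the minimum t-norm. -/
theorem standardGodel_imp (a c : Set.Icc (0 : ℝ) 1) :
    IsLUB {b : Set.Icc (0 : ℝ) 1 | min b a ≤ c} (standardGodel.imp a c) := by
  change IsLUB _ (godelImp 1 a c)
  unfold godelImp
  split_ifs with h
  · exact ⟨fun b _ => b.2.2, fun b hb => hb (show min 1 a ≤ c from (min_le_right _ _).trans h)⟩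
  · refine ⟨fun b hb => ?_, fun b hb => hb (show min c a ≤ c from min_le_left _ _)⟩
    rcases min_le_iff.1 (show min b a ≤ c from hb) with hb | hb
    · exact hb
    · exact absurd hb h

/-- Gödel algebras: the variety generated by the standard Gödel algebra. -/
def GA : Set (Alg Empty) := varietyGen {standardGodel}

/-- The indices of the rational constants: `[0, 1] ∩ ℚ`. -/
abbrev UnitRat : Type := Set.Icc (0 : ℚ) 1

/-- The bookkeeping axioms for the minimum t-norm and its residuum. -/
structure Bookkeeping (A : Alg UnitRat) : Prop where
  mul : ∀ p q : UnitRat, A.mul (A.cst p) (A.cst q) = A.cst (min p q)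
  imp : ∀ p q : UnitRat, A.imp (A.cst p) (A.cst q) = A.cst (godelImp 1 p q)
  zero : A.cst 0 = A.zero
  one : A.cst 1 = A.one

/-- Rational Gödel algebras. -/
def RGA : Set (Alg UnitRat) := {A | A.reduct ∈ GA ∧ Bookkeeping A}

/-- Rational Gödel chains: totally ordered rational Gödel algebras. -/
def IsChainRGA (A : Alg UnitRat) : Prop :=
  A ∈ RGA ∧ ∀ a b : A.carrier, A.le a b ∨ A.le b a

/-- The equation `φ ≈ 1`. -/
def eqOne {C : Type} (φ : Fm C) : Equation C ℕ := (φ, .one)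

/-- Rational Gödel logic. -/
def RG : Logic UnitRat where
  Entails Γ φ := ∃ Δ ⊆ Γ, Δ.Finite ∧ EqConsequence RGA (eqOne '' Δ) (eqOne φ)
  reflexive {Γ φ} h :=
    ⟨{φ}, by simpa using h, Set.finite_singleton _, fun A _ v hv => hv _ ⟨φ, rfl, rfl⟩⟩
  cut {Γ Δ φ} h := by
    rintro ⟨Δ', hΔ', hfin, hφ⟩
    choose! F hF using h
    refine ⟨⋃ ψ ∈ Δ', F ψ, Set.iUnion₂_subset fun ψ hψ => (hF ψ (hΔ' hψ)).1,
      hfin.biUnion fun ψ hψ => (hF ψ (hΔ' hψ)).2.1, fun A hA v hv => hφ A hA v ?_⟩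
    rintro _ ⟨ψ, hψ, rfl⟩
    refine (hF ψ (hΔ' hψ)).2.2 A hA v ?_
    rintro _ ⟨χ, hχ, rfl⟩
    exact hv _ ⟨χ, Set.mem_biUnion hψ hχ, rfl⟩
  substitution {Γ φ} σ := by
    rintro ⟨Δ, hΔ, hfin, hφ⟩
    refine ⟨Tm.subst σ '' Δ, Set.image_mono hΔ, hfin.image _, fun A hA v hv => ?_⟩
    have := hφ A hA (fun x => (σ x).eval A v) ?_
    · simpa [Alg.Solves, eqOne, Tm.eval_subst, Tm.eval] using this
    · rintro _ ⟨ψ, hψ, rfl⟩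
      have := hv _ ⟨ψ.subst σ, ⟨ψ, hψ, rfl⟩, rfl⟩
      simpa [Alg.Solves, eqOne, Tm.eval_subst, Tm.eval] using this
  finitary {Γ φ} := by
    rintro ⟨Δ, hΔ, hfin, hφ⟩
    exact ⟨Δ, hΔ, hfin, Δ, subset_rfl, hfin, hφ⟩

/-! ### The chains `Q_r` and `Q_p^γ` -/

/-- The universe `([0, r) ∩ ℚ) ∪ {1}` of `Q_r`, with the order of `ℚ`. -/
abbrev QrCarrier (r : Set.Ioc (0 : ℝ) 1) : Type :=
  {q : ℚ // (0 ≤ q ∧ (q : ℝ) < r) ∨ q = 1}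

/-- The chain `Q_r`, for a real `r ∈ (0, 1]`: the constant for `q` is `q` if `q < r`, and `1`
otherwise. -/
noncomputable def Qr (r : Set.Ioc (0 : ℝ) 1) : Alg UnitRat :=
  open Classical in
  godelChain (QrCarrier r) ⟨0, Or.inl ⟨le_rfl, by exact_mod_cast r.2.1⟩⟩ ⟨1, Or.inr rfl⟩
    (fun q => if h : ((q : ℚ) : ℝ) < r then ⟨q, Or.inl ⟨q.2.1, h⟩⟩ else ⟨1, Or.inr rfl⟩)

/-- The universe of `Q_p^γ`: the interval `[0, p] ∩ ℚ`, above it the elements `t_n` with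
`n < γ` in their natural order, and a greatest element `⊤`, which plays the role of `1`.
The ordinals `γ ∈ ω + 1` are the elements of `ℕ∞`. -/
abbrev QpCarrier (p : Set.Ico (0 : ℚ) 1) (γ : ℕ∞) : Type :=
  WithTop (Set.Icc (0 : ℚ) p ⊕ₗ {n : ℕ // (n : ℕ∞) < γ})

/-- The element `q` of `Q_p^γ`, for `q ∈ [0, p] ∩ ℚ`. -/
def QpCarrier.rat {p : Set.Ico (0 : ℚ) 1} {γ : ℕ∞} (q : Set.Icc (0 : ℚ) p) : QpCarrier p γ :=
  WithTop.some (Sum.inlₗ q)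

/-- The element `t_n` of `Q_p^γ`, for `n < γ`. -/
def QpCarrier.t {p : Set.Ico (0 : ℚ) 1} {γ : ℕ∞} (n : {n : ℕ // (n : ℕ∞) < γ}) :
    QpCarrier p γ :=
  WithTop.some (Sum.inrₗ n)

/-- The order of `Q_p^γ`. -/
theorem QpCarrier.order {p : Set.Ico (0 : ℚ) 1} {γ : ℕ∞} :
    (∀ a b : Set.Icc (0 : ℚ) p, (rat a : QpCarrier p γ) ≤ rat b ↔ (a : ℚ) ≤ b) ∧
    (∀ n m : {n : ℕ // (n : ℕ∞) < γ}, (t n : QpCarrier p γ) ≤ t m ↔ (n : ℕ) ≤ m) ∧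
    (∀ (a : Set.Icc (0 : ℚ) p) (n : {n : ℕ // (n : ℕ∞) < γ}), (rat a : QpCarrier p γ) < t n) ∧
    (∀ a : Set.Icc (0 : ℚ) p, (rat a : QpCarrier p γ) < ⊤) ∧
    (∀ n : {n : ℕ // (n : ℕ∞) < γ}, (t n : QpCarrier p γ) < ⊤) := by
  refine ⟨fun a b => ?_, fun n m => ?_, fun a n => ?_, fun a => WithTop.coe_lt_top _,
    fun n => WithTop.coe_lt_top _⟩
  · simp [rat, Sum.inlₗ]
  · simp [t, Sum.inrₗ]
  · simp [rat, t, Sum.inlₗ, Sum.inrₗ]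

/-- The chain `Q_p^γ`, for a rational `p ∈ [0, 1)` and `γ ∈ ω + 1`: the constant for `q` is `q`
if `q ≤ p`, and `1` otherwise. -/
def Qp (p : Set.Ico (0 : ℚ) 1) (γ : ℕ∞) : Alg UnitRat :=
  godelChain (QpCarrier p γ) (QpCarrier.rat ⟨0, le_rfl, p.2.1⟩) ⊤
    (fun q => if h : (q : ℚ) ≤ p then QpCarrier.rat ⟨q, q.2.1, h⟩ else ⊤)

end RatGodel

namespace RatGodel

/-! ### Evaluation in chains -/

/-! Every extension `L` of rational Gödel logic has a canonical chain: the constants, with `c_q`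
collapsed to 1 exactly when it is a theorem, and, if there is a greatest index `p` with `c_p` not a
theorem, a sequence of new elements above `c_p`, as long as the theorems of `L` permit
(`IsCanonical`, `exists_isCanonical`). These chains are the trivial one, the `Q_r` and the `Q_p^γ`.

The canonical chain decides admissibility (`IsCanonical.admissible_iff`). Each of its elements is
represented by a formula, a constant or some `chainFm p n`, and in every chain satisfying the
theorems of `L` these formulas respect the order, strictly until 1 is reached. Substituting them for
the variables therefore turns a valuation in the canonical chain into a substitution, so admissible
rules are valid there. Conversely, a formula that fails in some chain satisfying the theorems of `L`
fails in the canonical chain, since finite parts embed into it (`IsCanonical.exists_embedding`).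
Completeness with respect to such chains (`exists_chain_of_not_entails`) comes from Lindenbaum
algebras of linear theories.

If `L` is actively structurally complete, weakening all premises and the conclusion of a rule by a
fresh disjunct makes the rule active; hence `L` is the logic of its canonical chain
(`IsCanonical.entails_iff_of_ASC`) and is algebraized by the quasivariety that this chain generates.
Conversely, let `L` be an extension of the logic of some chain. A failing rule may be refuted in a
chain where no constant of the rule becomes 1 unless it is a theorem, and such a refutation moves to
the canonical chain of `L`; thus `L` is structurally complete (`IsCanonical.entails_of_chainValid`).
The shape of the generator follows because two chains with the same valid finite rules generate the
same quasivariety. -/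

/-- The variables of a term. -/
def Tm.vars {C α : Type} : Tm C α → List α
  | .var x => [x]
  | .cst _ => []
  | .inf s t => s.vars ++ t.vars
  | .sup s t => s.vars ++ t.vars
  | .mul s t => s.vars ++ t.vars
  | .imp s t => s.vars ++ t.vars
  | .zero => []
  | .one => []

/-- The constants from `C` in a term. -/
def Tm.csts {C α : Type} : Tm C α → List C
  | .var _ => []
  | .cst c => [c]
  | .inf s t => s.csts ++ t.csts
  | .sup s t => s.csts ++ t.csts
  | .mul s t => s.csts ++ t.csts
  | .imp s t => s.csts ++ t.csts
  | .zero => []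
  | .one => []

/-- The value of a term in a chain. -/
def cev {C α X : Type} [LinearOrder X] (bot top : X) (k : C → X) (v : α → X) (t : Tm C α) : X :=
  t.eval (godelChain X bot top k) v

/-- A relation between two chains that is monotone, and strictly monotone as long as the
second component is not the greatest element, is compatible with the operations. -/
theorem eval_rel {C α X Y : Type} [LinearOrder X] [LinearOrder Y] {bot top : X} {bot' top' : Y}
    {k : C → X} {k' : C → Y} (R : X → Y → Prop)
    (hle : ∀ {a b a' b'}, R a b → R a' b' → a ≤ a' → b ≤ b')
    (hlt : ∀ {a b a' b'}, R a b → R a' b' → a < a' → b < b' ∨ b = top')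
    (htop' : ∀ b, b ≤ top') (hbot : R bot bot') (htop : R top top')
    {v : α → X} {w : α → Y} (t : Tm C α) (hv : ∀ x ∈ t.vars, R (v x) (w x))
    (hk : ∀ c ∈ t.csts, R (k c) (k' c)) :
    R (cev bot top k v t) (cev bot' top' k' w t) := by
  have hmin : ∀ {a b a' b'}, R a b → R a' b' → R (min a a') (min b b') := by
    intro a b a' b' h h'
    rcases le_total a a' with h1 | h1
    · rw [min_eq_left h1, min_eq_left (hle h h' h1)]; exact h
    · rw [min_eq_right h1, min_eq_right (hle h' h h1)]; exact h'
  have hmax : ∀ {a b a' b'}, R a b → R a' b' → R (max a a') (max b b') := by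
    intro a b a' b' h h'
    rcases le_total a a' with h1 | h1
    · rw [max_eq_right h1, max_eq_right (hle h h' h1)]; exact h'
    · rw [max_eq_left h1, max_eq_left (hle h' h h1)]; exact h
  have himp : ∀ {a b a' b'}, R a b → R a' b' → R (godelImp top a a') (godelImp top' b b') := by
    intro a b a' b' h h'
    rcases le_or_gt a a' with h1 | h1
    · rw [godelImp, if_pos h1, godelImp, if_pos (hle h h' h1)]; exact htop
    · rw [godelImp, if_neg h1.not_ge, godelImp]
      -- The implication on the left equals its conclusion here. If the partner of that conclusion
      -- is already the greatest element, both possible values on the right agree with it, so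
      -- strictness may fail there.
      rcases hlt h' h h1 with h2 | h2
      · rw [if_neg h2.not_ge]; exact h'
      · rw [if_pos (h2 ▸ htop' _)]; exact h2 ▸ h'
  induction t with
  | var x => exact hv x (by simp [Tm.vars])
  | cst c => exact hk c (by simp [Tm.csts])
  | zero => exact hbot
  | one => exact htop
  | inf s t ihs iht =>
    simp only [Tm.vars, Tm.csts, List.mem_append, or_imp, forall_and] at hv hk
    exact hmin (ihs hv.1 hk.1) (iht hv.2 hk.2)
  | mul s t ihs iht =>
    simp only [Tm.vars, Tm.csts, List.mem_append, or_imp, forall_and] at hv hk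
    exact hmin (ihs hv.1 hk.1) (iht hv.2 hk.2)
  | sup s t ihs iht =>
    simp only [Tm.vars, Tm.csts, List.mem_append, or_imp, forall_and] at hv hk
    exact hmax (ihs hv.1 hk.1) (iht hv.2 hk.2)
  | imp s t ihs iht =>
    simp only [Tm.vars, Tm.csts, List.mem_append, or_imp, forall_and] at hv hk
    exact himp (ihs hv.1 hk.1) (iht hv.2 hk.2)

/-- A strictly monotone map of a finite part of a linear order into `ℚ` extends to any larger
finite part. -/
theorem exists_strictMonoOn_extension {X : Type} [LinearOrder X] (V U : Finset X) (g : X → ℚ)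
    (hg : StrictMonoOn g V) :
    ∃ h : X → ℚ, StrictMonoOn h ↑(U ∪ V) ∧ ∀ x ∈ V, h x = g x := by
  classical
  induction U using Finset.induction_on with
  | empty => exact ⟨g, by simpa using hg, fun _ _ => rfl⟩
  | insert u U _ ih =>
    obtain ⟨h, hm, hV⟩ := ih
    by_cases hu : u ∈ U ∪ V
    · refine ⟨h, ?_, hV⟩
      rwa [Finset.insert_union, Finset.insert_eq_of_mem hu]
    -- Density and unboundedness of `ℚ` leave room for the new value between the finitely many
    -- values below and above it.
    · obtain ⟨q, hq1, hq2⟩ := Order.exists_between_finsets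
        (lo := ((U ∪ V).filter (· < u)).image h) (hi := ((U ∪ V).filter (u < ·)).image h) (by
          intro x hx y hy
          simp only [Finset.mem_image, Finset.mem_filter] at hx hy
          obtain ⟨a, ⟨ha, ha'⟩, rfl⟩ := hx
          obtain ⟨b, ⟨hb, hb'⟩, rfl⟩ := hy
          exact hm ha hb (ha'.trans hb'))
      refine ⟨Function.update h u q, ?_, fun x hx => ?_⟩
      · intro a ha b hb hab
        rw [Finset.insert_union, Finset.coe_insert, Set.mem_insert_iff, Finset.mem_coe] at ha hb
        rcases ha with rfl | ha <;> rcases hb with rfl | hb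
        · exact absurd hab (lt_irrefl _)
        · rw [Function.update_self, Function.update_of_ne hab.ne']
          exact hq2 _ (Finset.mem_image_of_mem _ (Finset.mem_filter.2 ⟨hb, hab⟩))
        · rw [Function.update_self, Function.update_of_ne hab.ne]
          exact hq1 _ (Finset.mem_image_of_mem _ (Finset.mem_filter.2 ⟨ha, hab⟩))
        · rw [Function.update_of_ne (by rintro rfl; exact hu ha),
            Function.update_of_ne (by rintro rfl; exact hu hb)]
          exact hm ha hb hab
      · rw [Function.update_of_ne (by rintro rfl; exact hu (Finset.mem_union_right _ hx))]
        exact hV x hx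

/-! ### Equations valid in Gödel algebras -/

/-- The algebras validating `e` form a variety that contains the standard algebra, hence all Gödel
algebras. Every identity below is thus checked by cases on the order of reals. -/
theorem solves_of_standard {C : Type} {A : Alg C} (hA : A.reduct ∈ GA) {e : Equation Empty ℕ}
    (he : standardGodel.Validates e) (v : ℕ → A.carrier) : A.reduct.Solves v e :=
  hA {B | B.Validates e} ⟨⟨{e}, by simp⟩, by simpa using he⟩ v

theorem solves_of_standard_of_bounds {C : Type} {A : Alg C} (hA : A.reduct ∈ GA)
    {e : Equation Empty ℕ} (he : ∀ v : ℕ → Set.Icc (0 : ℝ) 1, v 0 ≤ 1 → v 1 ≤ 1 → v 2 ≤ 1 →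
      0 ≤ v 0 → standardGodel.Solves v e) (v : ℕ → A.carrier) : A.reduct.Solves v e :=
  solves_of_standard hA (fun v => he v (v 0).2.2 (v 1).2.2 (v 2).2.2 (v 0).2.1) v

/-- Assignments of three values. -/
def assign {X : Type} (a b c : X) : ℕ → X
  | 0 => a
  | 1 => b
  | _ => c

theorem GA_inf_self {C : Type} {A : Alg C} (hA : A.reduct ∈ GA) (a : A.carrier) :
    A.inf a a = a :=
  solves_of_standard_of_bounds hA (e := (.inf (.var 0) (.var 0), (.var 0)))
    (fun v _ _ _ _ => by simp only [Alg.Solves, Tm.eval, standardGodel, godelChain]; grind)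
    (assign a a a)

theorem GA_inf_comm {C : Type} {A : Alg C} (hA : A.reduct ∈ GA) (a b : A.carrier) :
    A.inf a b = A.inf b a :=
  solves_of_standard_of_bounds hA (e := (.inf (.var 0) (.var 1), .inf (.var 1) (.var 0)))
    (fun v _ _ _ _ => by simp only [Alg.Solves, Tm.eval, standardGodel, godelChain]; grind)
    (assign a b b)

theorem GA_inf_assoc {C : Type} {A : Alg C} (hA : A.reduct ∈ GA) (a b c : A.carrier) :
    A.inf (A.inf a b) c = A.inf a (A.inf b c) :=
  solves_of_standard_of_bounds hA
    (e := (.inf (.inf (.var 0) (.var 1)) (.var 2), .inf (.var 0) (.inf (.var 1) (.var 2))))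
    (fun v _ _ _ _ => by simp only [Alg.Solves, Tm.eval, standardGodel, godelChain]; grind)
    (assign a b c)

theorem GA_sup_comm {C : Type} {A : Alg C} (hA : A.reduct ∈ GA) (a b : A.carrier) :
    A.sup a b = A.sup b a :=
  solves_of_standard_of_bounds hA (e := (.sup (.var 0) (.var 1), .sup (.var 1) (.var 0)))
    (fun v _ _ _ _ => by simp only [Alg.Solves, Tm.eval, standardGodel, godelChain]; grind)
    (assign a b b)

theorem GA_sup_absorb {C : Type} {A : Alg C} (hA : A.reduct ∈ GA) (a b : A.carrier) :
    A.sup (A.inf a b) b = b :=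
  solves_of_standard_of_bounds hA (e := (.sup (.inf (.var 0) (.var 1)) (.var 1), (.var 1)))
    (fun v _ _ _ _ => by simp only [Alg.Solves, Tm.eval, standardGodel, godelChain]; grind)
    (assign a b b)

theorem GA_mul {C : Type} {A : Alg C} (hA : A.reduct ∈ GA) (a b : A.carrier) :
    A.mul a b = A.inf a b :=
  solves_of_standard_of_bounds hA (e := (.mul (.var 0) (.var 1), .inf (.var 0) (.var 1)))
    (fun _ _ _ _ _ => rfl) (assign a b b)

theorem GA_zero_inf {C : Type} {A : Alg C} (hA : A.reduct ∈ GA) (a : A.carrier) :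
    A.inf A.zero a = A.zero :=
  solves_of_standard_of_bounds hA (e := (.inf .zero (.var 0), .zero))
    (fun v _ _ _ _ => by simp only [Alg.Solves, Tm.eval, standardGodel, godelChain]; grind)
    (assign a a a)

theorem GA_inf_one {C : Type} {A : Alg C} (hA : A.reduct ∈ GA) (a : A.carrier) :
    A.inf a A.one = a :=
  solves_of_standard_of_bounds hA (e := (.inf (.var 0) .one, (.var 0)))
    (fun v _ _ _ _ => by simp only [Alg.Solves, Tm.eval, standardGodel, godelChain]; grind)
    (assign a a a)

theorem GA_imp_of_inf {C : Type} {A : Alg C} (hA : A.reduct ∈ GA) (a b : A.carrier) :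
    A.imp (A.inf a b) b = A.one :=
  solves_of_standard_of_bounds hA (e := (.imp (.inf (.var 0) (.var 1)) (.var 1), .one))
    (fun v _ _ _ _ => by
      simp only [Alg.Solves, Tm.eval, standardGodel, godelChain, godelImp]; grind)
    (assign a b b)

theorem GA_inf_imp {C : Type} {A : Alg C} (hA : A.reduct ∈ GA) (a b : A.carrier) :
    A.inf a (A.imp a b) = A.inf a b :=
  solves_of_standard_of_bounds hA
    (e := (.inf (.var 0) (.imp (.var 0) (.var 1)), .inf (.var 0) (.var 1)))
    (fun v _ _ _ _ => by
      simp only [Alg.Solves, Tm.eval, standardGodel, godelChain, godelImp]; grind)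
    (assign a b b)

theorem GA_imp_self {C : Type} {A : Alg C} (hA : A.reduct ∈ GA) (a : A.carrier) :
    A.imp a a = A.one :=
  solves_of_standard_of_bounds hA (e := (.imp (.var 0) (.var 0), .one))
    (fun v _ _ _ _ => by
      simp only [Alg.Solves, Tm.eval, standardGodel, godelChain, godelImp]; grind)
    (assign a a a)

theorem GA_imp_one {C : Type} {A : Alg C} (hA : A.reduct ∈ GA) (a : A.carrier) :
    A.imp a A.one = A.one :=
  solves_of_standard_of_bounds hA (e := (.imp (.var 0) .one, .one))
    (fun v _ _ _ _ => by
      simp only [Alg.Solves, Tm.eval, standardGodel, godelChain, godelImp]; grind)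
    (assign a a a)

theorem GA_one_imp {C : Type} {A : Alg C} (hA : A.reduct ∈ GA) (a : A.carrier) :
    A.imp A.one a = a :=
  solves_of_standard_of_bounds hA (e := (.imp .one (.var 0), (.var 0)))
    (fun v _ _ _ _ => by
      simp only [Alg.Solves, Tm.eval, standardGodel, godelChain, godelImp]; grind)
    (assign a a a)

theorem GA_weaken {C : Type} {A : Alg C} (hA : A.reduct ∈ GA) (a b : A.carrier) :
    A.imp a (A.imp b a) = A.one :=
  solves_of_standard_of_bounds hA (e := (.imp (.var 0) (.imp (.var 1) (.var 0)), .one))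
    (fun v _ _ _ _ => by
      simp only [Alg.Solves, Tm.eval, standardGodel, godelChain, godelImp]; grind)
    (assign a b b)

theorem GA_distribute {C : Type} {A : Alg C} (hA : A.reduct ∈ GA) (a b c : A.carrier) :
    A.imp (A.imp a (A.imp b c)) (A.imp (A.imp a b) (A.imp a c)) = A.one :=
  solves_of_standard_of_bounds hA
    (e := (.imp (.imp (.var 0) (.imp (.var 1) (.var 2)))
      (.imp (.imp (.var 0) (.var 1)) (.imp (.var 0) (.var 2))), .one))
    (fun v _ _ _ _ => by
      simp only [Alg.Solves, Tm.eval, standardGodel, godelChain, godelImp]; grind)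
    (assign a b c)

theorem GA_inf_left {C : Type} {A : Alg C} (hA : A.reduct ∈ GA) (a b c : A.carrier) :
    A.imp (A.imp a b) (A.imp (A.inf a c) (A.inf b c)) = A.one :=
  solves_of_standard_of_bounds hA
    (e := (.imp (.imp (.var 0) (.var 1))
      (.imp (.inf (.var 0) (.var 2)) (.inf (.var 1) (.var 2))), .one))
    (fun v _ _ _ _ => by
      simp only [Alg.Solves, Tm.eval, standardGodel, godelChain, godelImp]; grind)
    (assign a b c)

theorem GA_inf_right {C : Type} {A : Alg C} (hA : A.reduct ∈ GA) (a b c : A.carrier) :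
    A.imp (A.imp a b) (A.imp (A.inf c a) (A.inf c b)) = A.one :=
  solves_of_standard_of_bounds hA
    (e := (.imp (.imp (.var 0) (.var 1))
      (.imp (.inf (.var 2) (.var 0)) (.inf (.var 2) (.var 1))), .one))
    (fun v _ _ _ _ => by
      simp only [Alg.Solves, Tm.eval, standardGodel, godelChain, godelImp]; grind)
    (assign a b c)

theorem GA_sup_left {C : Type} {A : Alg C} (hA : A.reduct ∈ GA) (a b c : A.carrier) :
    A.imp (A.imp a b) (A.imp (A.sup a c) (A.sup b c)) = A.one :=
  solves_of_standard_of_bounds hA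
    (e := (.imp (.imp (.var 0) (.var 1))
      (.imp (.sup (.var 0) (.var 2)) (.sup (.var 1) (.var 2))), .one))
    (fun v _ _ _ _ => by
      simp only [Alg.Solves, Tm.eval, standardGodel, godelChain, godelImp]; grind)
    (assign a b c)

theorem GA_sup_right {C : Type} {A : Alg C} (hA : A.reduct ∈ GA) (a b c : A.carrier) :
    A.imp (A.imp a b) (A.imp (A.sup c a) (A.sup c b)) = A.one :=
  solves_of_standard_of_bounds hA
    (e := (.imp (.imp (.var 0) (.var 1))
      (.imp (.sup (.var 2) (.var 0)) (.sup (.var 2) (.var 1))), .one))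
    (fun v _ _ _ _ => by
      simp only [Alg.Solves, Tm.eval, standardGodel, godelChain, godelImp]; grind)
    (assign a b c)

theorem GA_mul_left {C : Type} {A : Alg C} (hA : A.reduct ∈ GA) (a b c : A.carrier) :
    A.imp (A.imp a b) (A.imp (A.mul a c) (A.mul b c)) = A.one :=
  solves_of_standard_of_bounds hA
    (e := (.imp (.imp (.var 0) (.var 1))
      (.imp (.mul (.var 0) (.var 2)) (.mul (.var 1) (.var 2))), .one))
    (fun v _ _ _ _ => by
      simp only [Alg.Solves, Tm.eval, standardGodel, godelChain, godelImp]; grind)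
    (assign a b c)

theorem GA_mul_right {C : Type} {A : Alg C} (hA : A.reduct ∈ GA) (a b c : A.carrier) :
    A.imp (A.imp a b) (A.imp (A.mul c a) (A.mul c b)) = A.one :=
  solves_of_standard_of_bounds hA
    (e := (.imp (.imp (.var 0) (.var 1))
      (.imp (.mul (.var 2) (.var 0)) (.mul (.var 2) (.var 1))), .one))
    (fun v _ _ _ _ => by
      simp only [Alg.Solves, Tm.eval, standardGodel, godelChain, godelImp]; grind)
    (assign a b c)

theorem GA_imp_left {C : Type} {A : Alg C} (hA : A.reduct ∈ GA) (a b c : A.carrier) :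
    A.imp (A.imp a b) (A.imp (A.imp b c) (A.imp a c)) = A.one :=
  solves_of_standard_of_bounds hA
    (e := (.imp (.imp (.var 0) (.var 1))
      (.imp (.imp (.var 1) (.var 2)) (.imp (.var 0) (.var 2))), .one))
    (fun v _ _ _ _ => by
      simp only [Alg.Solves, Tm.eval, standardGodel, godelChain, godelImp]; grind)
    (assign a b c)

theorem GA_imp_right {C : Type} {A : Alg C} (hA : A.reduct ∈ GA) (a b c : A.carrier) :
    A.imp (A.imp a b) (A.imp (A.imp c a) (A.imp c b)) = A.one :=
  solves_of_standard_of_bounds hA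
    (e := (.imp (.imp (.var 0) (.var 1))
      (.imp (.imp (.var 2) (.var 0)) (.imp (.var 2) (.var 1))), .one))
    (fun v _ _ _ _ => by
      simp only [Alg.Solves, Tm.eval, standardGodel, godelChain, godelImp]; grind)
    (assign a b c)

/-- Prelinearity phrased with implication alone, the form in which it makes theories maximal without
a given formula linear. -/
theorem GA_prelinear {C : Type} {A : Alg C} (hA : A.reduct ∈ GA) (a b c : A.carrier) :
    A.imp (A.imp (A.imp a b) c) (A.imp (A.imp (A.imp b a) c) c) = A.one :=
  solves_of_standard_of_bounds hA
    (e := (.imp (.imp (.imp (.var 0) (.var 1)) (.var 2))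
      (.imp (.imp (.imp (.var 1) (.var 0)) (.var 2)) (.var 2)), .one))
    (fun v _ _ _ _ => by
      simp only [Alg.Solves, Tm.eval, standardGodel, godelChain, godelImp]; grind)
    (assign a b c)

/-! ### Rational Gödel chains -/

/-- The data of a rational Gödel chain: bounds and an interpretation of the constants. -/
structure RGChain (X : Type) [LinearOrder X] (bot top : X) (k : UnitRat → X) : Prop where
  bot_le : ∀ a, bot ≤ a
  le_top : ∀ a, a ≤ top
  zero : k 0 = bot
  one : k 1 = top
  mono : ∀ {p q}, p ≤ q → k p ≤ k q
  eq_top : ∀ {p q}, p < q → k q ≤ k p → k p = top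

theorem RGChain.lt {X : Type} [LinearOrder X] {bot top : X} {k : UnitRat → X}
    (h : RGChain X bot top k) {p q : UnitRat} (hpq : p < q) (hp : k p ≠ top) : k p < k q :=
  lt_of_not_ge fun hle => hp (h.eq_top hpq hle)

theorem RGChain.lt_iff {X : Type} [LinearOrder X] {bot top : X} {k : UnitRat → X}
    (h : RGChain X bot top k) {p q : UnitRat} (hp : k p ≠ top) : k p < k q ↔ p < q :=
  ⟨fun hlt => lt_of_not_ge fun hle => hlt.not_ge (h.mono hle), fun hlt => h.lt hlt hp⟩

theorem RGChain.inj {X : Type} [LinearOrder X] {bot top : X} {k : UnitRat → X}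
    (h : RGChain X bot top k) {p q : UnitRat} (hp : k p ≠ top) (hpq : k p = k q) : p = q := by
  rcases lt_trichotomy p q with hlt | heq | hlt
  · exact absurd hpq (h.lt hlt hp).ne
  · exact heq
  · exact absurd hpq.symm (h.lt hlt (hpq ▸ hp)).ne

/-- Every bounded chain is a Gödel algebra. -/
theorem godelChain_mem_GA {X : Type} [LinearOrder X] {bot top : X} (hbot : ∀ a, bot ≤ a)
    (htop : ∀ a, a ≤ top) : godelChain X bot top (Empty.elim : Empty → X) ∈ GA := by
  classical
  rintro K ⟨⟨E, rfl⟩, hK⟩ e he v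
  change ℕ → X at v
  by_cases hbt : bot = top
  · have : Subsingleton X :=
      ⟨fun a b => le_antisymm ((htop a).trans (hbt ▸ hbot b)) ((htop b).trans (hbt ▸ hbot a))⟩
    exact this.elim _ _
  have hlt : bot < top := lt_of_le_of_ne (hbot _) hbt
  -- An equation involves finitely many values; these are embedded into `[0, 1]` with the bounds
  -- pinned to 0 and 1, and a failure of the equation would be carried along.
  obtain ⟨g, hg, hgV⟩ := exists_strictMonoOn_extension {bot, top}
    ((e.1.vars ++ e.2.vars).map v).toFinset (fun a => if a = bot then 0 else 1) (by
      intro a ha b hb hab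
      simp only [Finset.coe_insert, Finset.coe_singleton, Set.mem_insert_iff,
        Set.mem_singleton_iff] at ha hb
      have hb' : b ≠ bot := fun h => (hab.trans_le (h ▸ hbot a)).false
      have ha' : a = bot := ha.resolve_right fun h => (hab.trans_le (h ▸ htop b)).false
      simp [hb', ha'])
  set U := ((e.1.vars ++ e.2.vars).map v).toFinset ∪ {bot, top} with hU
  have hbotU : bot ∈ U := by simp [hU]
  have htopU : top ∈ U := by simp [hU]
  have hgbot : g bot = 0 := by simpa using hgV bot (by simp)
  have hgtop : g top = 1 := by simpa [Ne.symm hbt] using hgV top (by simp)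
  have hg01 : ∀ a ∈ U, (g a : ℝ) ∈ Set.Icc (0 : ℝ) 1 := by
    intro a ha
    have h1 := hg.monotoneOn hbotU ha (hbot a)
    have h2 := hg.monotoneOn ha htopU (htop a)
    rw [hgbot] at h1
    rw [hgtop] at h2
    exact ⟨by exact_mod_cast h1, by exact_mod_cast h2⟩
  let f : X → Set.Icc (0 : ℝ) 1 := fun a => if h : a ∈ U then ⟨g a, hg01 a h⟩ else 0
  have hf : ∀ a ∈ U, ((f a : Set.Icc (0 : ℝ) 1) : ℝ) = g a := fun a ha => by simp [f, ha]
  have hfle : ∀ a ∈ U, ∀ b ∈ U, a ≤ b → f a ≤ f b := fun a ha b hb hab => by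
    rw [← Subtype.coe_le_coe, hf a ha, hf b hb]
    exact_mod_cast hg.monotoneOn ha hb hab
  have hflt : ∀ a ∈ U, ∀ b ∈ U, a < b → f a < f b := fun a ha b hb hab => by
    rw [← Subtype.coe_lt_coe, hf a ha, hf b hb]
    exact_mod_cast hg ha hb hab
  have key : ∀ t : Tm Empty ℕ, (∀ x ∈ t.vars, v x ∈ U) →
      cev bot top Empty.elim v t ∈ U ∧
      cev 0 1 Empty.elim (f ∘ v) t = f (cev bot top Empty.elim v t) := by
    intro t ht
    refine eval_rel (R := fun a b => a ∈ U ∧ b = f a) ?_ ?_ (fun b => b.2.2) ⟨hbotU, ?_⟩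
      ⟨htopU, ?_⟩ t (fun x hx => ⟨ht x hx, rfl⟩) (fun c => c.elim)
    · rintro a _ a' _ ⟨ha, rfl⟩ ⟨ha', rfl⟩ h
      exact hfle a ha a' ha' h
    · rintro a _ a' _ ⟨ha, rfl⟩ ⟨ha', rfl⟩ h
      exact Or.inl (hflt a ha a' ha' h)
    · exact Subtype.ext (by rw [hf _ hbotU, hgbot]; simp)
    · exact Subtype.ext (by rw [hf _ htopU, hgtop]; simp)
  obtain ⟨h1, h1'⟩ := key e.1 fun x hx => by
    simp only [hU, List.map_append, Finset.mem_union, List.mem_toFinset, List.mem_append,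
      List.mem_map]
    exact Or.inl (Or.inl ⟨x, hx, rfl⟩)
  obtain ⟨h2, h2'⟩ := key e.2 fun x hx => by
    simp only [hU, List.map_append, Finset.mem_union, List.mem_toFinset, List.mem_append,
      List.mem_map]
    exact Or.inl (Or.inr ⟨x, hx, rfl⟩)
  have hs : cev 0 1 Empty.elim (f ∘ v) e.1 = cev 0 1 Empty.elim (f ∘ v) e.2 :=
    hK (Set.mem_singleton _) e he (f ∘ v)
  rw [h1', h2'] at hs
  rcases lt_trichotomy (α := X) (cev bot top Empty.elim v e.1) (cev bot top Empty.elim v e.2)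
    with h | h | h
  · exact absurd hs (hflt _ h1 _ h2 h).ne
  · exact h
  · exact absurd hs (hflt _ h2 _ h1 h).ne'

theorem RGChain.isChainRGA {X : Type} [LinearOrder X] {bot top : X} {k : UnitRat → X}
    (h : RGChain X bot top k) : IsChainRGA (godelChain X bot top k) := by
  have hGA := godelChain_mem_GA h.bot_le h.le_top
  refine ⟨⟨hGA, ⟨fun p q => ?_, fun p q => ?_, h.zero, h.one⟩⟩,
    fun a b => ?_⟩
  · have : @min X _ (k p) (k q) = k (min p q) := by
      rcases le_total p q with hpq | hpq
      · rw [min_eq_left hpq, min_eq_left (h.mono hpq)]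
      · rw [min_eq_right hpq, min_eq_right (h.mono hpq)]
    exact this
  · have : godelImp top (k p) (k q) = k (godelImp 1 p q) := by
      rcases le_or_gt p q with hpq | hpq
      · rw [godelImp, if_pos (h.mono hpq), godelImp, if_pos hpq, h.one]
      · rw [godelImp, godelImp, if_neg hpq.not_ge]
        split_ifs with hle
        · exact (h.eq_top hpq hle).symm
        · rfl
    exact this
  · have : ∀ a b : X, min a b = a ∨ min b a = b := fun a b =>
      (le_total a b).imp (fun h => min_eq_left h) (fun h => min_eq_left h)
    exact this a b

theorem GA_imp_eq_one_iff {C : Type} {A : Alg C} (hA : A.reduct ∈ GA) {a b : A.carrier} :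
    A.imp a b = A.one ↔ A.inf a b = a := by
  constructor
  · intro h
    rw [← GA_inf_imp hA, h, GA_inf_one hA]
  · intro h
    rw [← h, GA_imp_of_inf hA]

/-- A rational Gödel chain is determined by its order and the interpretation of the
constants. -/
theorem IsChainRGA.exists_eq {A : Alg UnitRat} (h : IsChainRGA A) :
    ∃ (X : Type) (_ : LinearOrder X) (bot top : X) (k : UnitRat → X),
      RGChain X bot top k ∧ A = godelChain X bot top k := by
  classical
  obtain ⟨⟨hA, hB⟩, htot⟩ := h
  let lo : LinearOrder A.carrier :=
    { le := A.le
      le_refl := GA_inf_self hA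
      le_trans := fun a b c (h1 : A.inf a b = a) (h2 : A.inf b c = b) => by
        change A.inf a c = a
        rw [← h1, GA_inf_assoc hA, h2]
      le_antisymm := fun a b (h1 : A.inf a b = a) (h2 : A.inf b a = b) => by
        rw [← h1, GA_inf_comm hA, h2]
      le_total := htot
      toDecidableLE := Classical.decRel _ }
  have hinf : A.inf = min := by
    funext a b
    rcases le_total a b with hab | hab
    · rw [min_eq_left hab]; exact hab
    · rw [min_eq_right hab, GA_inf_comm hA]; exact hab
  have hsup : A.sup = max := by
    funext a b
    rcases le_total a b with hab | hab
    · have := GA_sup_absorb hA a b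
      rwa [max_eq_right hab, ← show A.inf a b = a from hab]
    · have := GA_sup_absorb hA b a
      rw [max_eq_left hab, GA_sup_comm hA]
      rwa [show A.inf b a = b from hab] at this
  have hmul : A.mul = min := by
    funext a b
    rw [GA_mul hA, hinf]
  have hle : ∀ {a b : A.carrier}, A.imp a b = A.one ↔ a ≤ b := GA_imp_eq_one_iff hA
  have himp : A.imp = godelImp A.one := by
    funext a b
    rw [godelImp]
    split_ifs with hab
    · exact hle.2 hab
    · have h1 := GA_inf_imp hA a b
      rw [hinf, min_eq_right (le_of_not_ge hab)] at h1
      rcases min_choice a (A.imp a b) with h2 | h2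
      · exact absurd (h2.symm.trans h1).le hab
      · exact h2.symm.trans h1
  have hone : ∀ a, a ≤ A.one := GA_inf_one hA
  have hkle : ∀ {p q}, p ≤ q → A.cst p ≤ A.cst q := fun {p q} hpq => by
    have := hB.mul p q
    rw [min_eq_left hpq, hmul] at this
    exact min_eq_left_iff.1 this
  refine ⟨A.carrier, lo, A.zero, A.one, A.cst,
    ⟨GA_zero_inf hA, hone, hB.zero, hB.one, hkle, fun {p q} hpq hqp => ?_⟩, ?_⟩
  -- For `p < q` bookkeeping makes `c_q → c_p` equal to `c_p`, while `c_q ≤ c_p` in the algebra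
  -- makes it equal to 1.
  · rw [← hle.2 hqp, hB.imp, godelImp, if_neg hpq.not_ge]
  · have : ∀ i s m p, i = min → s = max → m = min → p = godelImp A.one →
        Alg.mk A.carrier i s m p A.zero A.one A.cst =
          godelChain A.carrier A.zero A.one A.cst := by
      rintro _ _ _ _ rfl rfl rfl rfl
      rfl
    exact this _ _ _ _ hinf hsup hmul himp

/-! ### Theories and their Lindenbaum algebras -/

theorem RG_isTheorem {φ : Fm UnitRat}
    (h : ∀ A ∈ RGA, ∀ v : ℕ → A.carrier, φ.eval A v = A.one) : RG.IsTheorem φ :=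
  ⟨∅, subset_rfl, Set.finite_empty, fun A hA v _ => h A hA v⟩

theorem RG_entails {Γ : Set (Fm UnitRat)} {φ : Fm UnitRat} (hΓ : Γ.Finite)
    (h : ∀ A ∈ RGA, ∀ v : ℕ → A.carrier, (∀ γ ∈ Γ, γ.eval A v = A.one) → φ.eval A v = A.one) :
    RG.Entails Γ φ :=
  ⟨Γ, subset_rfl, hΓ, fun A hA v hv => h A hA v fun γ hγ => hv _ ⟨γ, hγ, rfl⟩⟩

/-- Sets of formulas that contain the theorems of rational Gödel logic and are closed under
modus ponens. -/
structure IsTheory (T : Set (Fm UnitRat)) : Prop where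
  thm : ∀ {φ}, RG.IsTheorem φ → φ ∈ T
  mp : ∀ {α β}, Tm.imp α β ∈ T → α ∈ T → β ∈ T

theorem RG_imp_self (α : Fm UnitRat) : RG.IsTheorem (.imp α α) :=
  RG_isTheorem fun _ hA _ => GA_imp_self hA.1 _

theorem RG_weaken (α β : Fm UnitRat) : RG.IsTheorem (.imp α (.imp β α)) :=
  RG_isTheorem fun _ hA _ => GA_weaken hA.1 _ _

theorem RG_distribute (α β γ : Fm UnitRat) :
    RG.IsTheorem (.imp (.imp α (.imp β γ)) (.imp (.imp α β) (.imp α γ))) :=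
  RG_isTheorem fun _ hA _ => GA_distribute hA.1 _ _ _

theorem RG_prelinear (α β γ : Fm UnitRat) :
    RG.IsTheorem (.imp (.imp (.imp α β) γ) (.imp (.imp (.imp β α) γ) γ)) :=
  RG_isTheorem fun _ hA _ => GA_prelinear hA.1 _ _ _

theorem IsTheory.mp_thm {T : Set (Fm UnitRat)} (hT : IsTheory T) {α β : Fm UnitRat}
    (hα : α ∈ T) (h : RG.IsTheorem (.imp α β)) : β ∈ T := hT.mp (hT.thm h) hα

theorem IsTheory.trans {T : Set (Fm UnitRat)} (hT : IsTheory T) {α β γ : Fm UnitRat}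
    (hαβ : Tm.imp α β ∈ T) (hβγ : Tm.imp β γ ∈ T) : Tm.imp α γ ∈ T :=
  hT.mp (α := .imp β γ)
    (hT.mp_thm hαβ (RG_isTheorem fun _ hA _ => GA_imp_left hA.1 _ _ _)) hβγ

/-- Interderivability modulo a theory. -/
def lindSetoid {T : Set (Fm UnitRat)} (hT : IsTheory T) : Setoid (Fm UnitRat) where
  r α β := Tm.imp α β ∈ T ∧ Tm.imp β α ∈ T
  iseqv :=
    { refl := fun α => ⟨hT.thm (RG_imp_self α), hT.thm (RG_imp_self α)⟩
      symm := fun h => ⟨h.2, h.1⟩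
      trans := fun h₁ h₂ => ⟨hT.trans h₁.1 h₂.1, hT.trans h₂.2 h₁.2⟩ }

/-- An operation that is monotone or antitone modulo `T` in each argument respects
interderivability modulo `T`. -/
theorem lindSetoid_congr {T : Set (Fm UnitRat)} (hT : IsTheory T)
    (op : Fm UnitRat → Fm UnitRat → Fm UnitRat)
    (hl : ∀ α β γ, (lindSetoid hT) α β → Tm.imp (op α γ) (op β γ) ∈ T)
    (hr : ∀ α β γ, (lindSetoid hT) α β → Tm.imp (op γ α) (op γ β) ∈ T)
    {α α' β β' : Fm UnitRat} (hα : (lindSetoid hT) α α') (hβ : (lindSetoid hT) β β') :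
    (lindSetoid hT) (op α β) (op α' β') :=
  ⟨hT.trans (hl _ _ _ hα) (hr _ _ _ hβ),
    hT.trans (hl _ _ _ ((lindSetoid hT).symm hα)) (hr _ _ _ ((lindSetoid hT).symm hβ))⟩

/-- The Lindenbaum algebra of a theory. -/
def lind {T : Set (Fm UnitRat)} (hT : IsTheory T) : Alg UnitRat where
  carrier := Quotient (lindSetoid hT)
  inf := Quotient.map₂ .inf fun _ _ h _ _ h' => lindSetoid_congr hT .inf
    (fun _ _ _ h => hT.mp_thm h.1 (RG_isTheorem fun _ hA _ => GA_inf_left hA.1 _ _ _))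
    (fun _ _ _ h => hT.mp_thm h.1 (RG_isTheorem fun _ hA _ => GA_inf_right hA.1 _ _ _)) h h'
  sup := Quotient.map₂ .sup fun _ _ h _ _ h' => lindSetoid_congr hT .sup
    (fun _ _ _ h => hT.mp_thm h.1 (RG_isTheorem fun _ hA _ => GA_sup_left hA.1 _ _ _))
    (fun _ _ _ h => hT.mp_thm h.1 (RG_isTheorem fun _ hA _ => GA_sup_right hA.1 _ _ _)) h h'
  mul := Quotient.map₂ .mul fun _ _ h _ _ h' => lindSetoid_congr hT .mul
    (fun _ _ _ h => hT.mp_thm h.1 (RG_isTheorem fun _ hA _ => GA_mul_left hA.1 _ _ _))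
    (fun _ _ _ h => hT.mp_thm h.1 (RG_isTheorem fun _ hA _ => GA_mul_right hA.1 _ _ _)) h h'
  imp := Quotient.map₂ .imp fun _ _ h _ _ h' => lindSetoid_congr hT .imp
    (fun _ _ _ h => hT.mp_thm h.2 (RG_isTheorem fun _ hA _ => GA_imp_left hA.1 _ _ _))
    (fun _ _ _ h => hT.mp_thm h.1 (RG_isTheorem fun _ hA _ => GA_imp_right hA.1 _ _ _)) h h'
  zero := Quotient.mk _ .zero
  one := Quotient.mk _ .one
  cst c := Quotient.mk _ (.cst c)

/-- The class of a formula in the Lindenbaum algebra. -/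
def lindMk {T : Set (Fm UnitRat)} (hT : IsTheory T) (α : Fm UnitRat) : (lind hT).carrier :=
  Quotient.mk _ α

theorem lindMk_eq {T : Set (Fm UnitRat)} (hT : IsTheory T) {α β : Fm UnitRat} :
    lindMk hT α = lindMk hT β ↔ Tm.imp α β ∈ T ∧ Tm.imp β α ∈ T :=
  ⟨fun h => Quotient.exact h, fun h => Quotient.sound h⟩

theorem lindMk_eq_one {T : Set (Fm UnitRat)} (hT : IsTheory T) {α : Fm UnitRat} :
    lindMk hT α = (lind hT).one ↔ α ∈ T := by
  refine (lindMk_eq hT (β := .one)).trans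
    ⟨fun h => hT.mp h.2 (hT.thm (RG_isTheorem fun _ _ _ => rfl)), fun h => ⟨?_, ?_⟩⟩
  · exact hT.thm (RG_isTheorem fun _ hA _ => GA_imp_one hA.1 _)
  · exact hT.mp_thm h (RG_weaken _ _)

theorem Tm.subst_var {C α : Type} (t : Tm C α) : t.subst .var = t := by
  induction t <;> simp_all [Tm.subst]

theorem lind_eval {α : Type} {T : Set (Fm UnitRat)} (hT : IsTheory T) (σ : α → Fm UnitRat)
    (t : Tm UnitRat α) :
    t.eval (lind hT) (fun n => lindMk hT (σ n)) = lindMk hT (t.subst σ) := by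
  induction t with
  | var x => rfl
  | cst c => rfl
  | zero => rfl
  | one => rfl
  | inf s t ihs iht => simp only [Tm.eval, ihs, iht]; rfl
  | sup s t ihs iht => simp only [Tm.eval, ihs, iht]; rfl
  | mul s t ihs iht => simp only [Tm.eval, ihs, iht]; rfl
  | imp s t ihs iht => simp only [Tm.eval, ihs, iht]; rfl

theorem exists_lindMk_comp {α : Type} {T : Set (Fm UnitRat)} (hT : IsTheory T)
    (v : α → (lind hT).carrier) : ∃ σ : α → Fm UnitRat, v = fun n => lindMk hT (σ n) :=
  ⟨fun n => (v n).out, funext fun n => ((v n).out_eq).symm⟩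

/-- The inclusion of the terms without rational constants. -/
def Tm.embed {C α : Type} : Tm Empty α → Tm C α
  | .var x => .var x
  | .cst c => c.elim
  | .inf s t => .inf s.embed t.embed
  | .sup s t => .sup s.embed t.embed
  | .mul s t => .mul s.embed t.embed
  | .imp s t => .imp s.embed t.embed
  | .zero => .zero
  | .one => .one

theorem Tm.eval_embed {C α : Type} (A : Alg C) (v : α → A.carrier) (t : Tm Empty α) :
    t.embed.eval A v = t.eval A.reduct v := by
  induction t with
  | cst c => exact c.elim
  | _ => simp_all [Tm.embed, Tm.eval, Alg.reduct]

/-- If two formulas agree in all rational Gödel algebras, both implications between them are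
theorems and lie in `T`; so every defining equation passes to the quotient. -/
theorem lind_mem_RGA {T : Set (Fm UnitRat)} (hT : IsTheory T) : lind hT ∈ RGA := by
  have key : ∀ {α β : Fm UnitRat}, (∀ A ∈ RGA, ∀ v : ℕ → A.carrier, α.eval A v = β.eval A v) →
      lindMk hT α = lindMk hT β := fun {α β} h => by
    refine (lindMk_eq hT).2 ⟨hT.thm (RG_isTheorem fun A hA v => ?_),
      hT.thm (RG_isTheorem fun A hA v => ?_)⟩
    · simp only [Tm.eval, h A hA v, GA_imp_self hA.1]
    · simp only [Tm.eval, h A hA v, GA_imp_self hA.1]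
  refine ⟨?_, fun p q => ?_, fun p q => ?_, ?_, ?_⟩
  · rintro K ⟨⟨E, rfl⟩, hK⟩ e he v
    obtain ⟨σ, hσ⟩ := exists_lindMk_comp hT v
    refine (Tm.eval_embed (lind hT) v e.1).symm.trans
      (Eq.trans ?_ (Tm.eval_embed (lind hT) v e.2))
    rw [hσ, lind_eval, lind_eval]
    refine key fun A hA w => ?_
    rw [Tm.eval_subst, Tm.eval_subst, Tm.eval_embed, Tm.eval_embed]
    exact solves_of_standard hA.1 (hK (Set.mem_singleton _) e he) _
  · exact key (α := .mul (.cst p) (.cst q)) (β := .cst _) fun A hA _ => hA.2.mul p q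
  · exact key (α := .imp (.cst p) (.cst q)) (β := .cst _) fun A hA _ => hA.2.imp p q
  · exact key (α := .cst 0) (β := .zero) fun A hA _ => hA.2.zero
  · exact key (α := .cst 1) (β := .one) fun A hA _ => hA.2.one

/-- The deductive closure of a theory and one more formula. -/
theorem IsTheory.adjoin {T : Set (Fm UnitRat)} (hT : IsTheory T) (α : Fm UnitRat) :
    IsTheory {β | Tm.imp α β ∈ T} :=
  ⟨fun h => hT.mp_thm (hT.thm h) (RG_weaken _ _),
    fun h₁ h₂ => hT.mp (hT.mp_thm h₁ (RG_distribute _ _ _)) h₂⟩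

/-- A theory without `φ` extends to a linear one. -/
theorem IsTheory.exists_linear {T : Set (Fm UnitRat)} (hT : IsTheory T) {φ : Fm UnitRat}
    (hφ : φ ∉ T) : ∃ T' : Set (Fm UnitRat), T ⊆ T' ∧ IsTheory T' ∧ φ ∉ T' ∧
      ∀ α β, Tm.imp α β ∈ T' ∨ Tm.imp β α ∈ T' := by
  obtain ⟨M, hTM, hM⟩ := zorn_subset_nonempty {S | IsTheory S ∧ φ ∉ S} (by
    intro c hc hchain hne
    refine ⟨⋃₀ c, ⟨⟨fun h => ?_, fun {α β} h h' => ?_⟩, ?_⟩,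
      fun S hS => Set.subset_sUnion_of_mem hS⟩
    · obtain ⟨S, hS⟩ := hne
      exact ⟨S, hS, (hc hS).1.thm h⟩
    · obtain ⟨S, hS, h⟩ := h
      obtain ⟨S', hS', h'⟩ := h'
      rcases hchain.total hS hS' with hle | hle
      · exact ⟨S', hS', (hc hS').1.mp (hle h) h'⟩
      · exact ⟨S, hS, (hc hS).1.mp h (hle h')⟩
    · rintro ⟨S, hS, h⟩
      exact (hc hS).2 h) T ⟨hT, hφ⟩
  have hMT := hM.prop.1
  -- Otherwise adjoining `α` would give a strictly larger theory that still omits `φ`.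
  have hout : ∀ α, α ∉ M → Tm.imp α φ ∈ M := by
    intro α hα
    by_contra hno
    exact hα (hM.le_of_ge (y := {β | Tm.imp α β ∈ M}) ⟨hMT.adjoin α, hno⟩
      (fun β hβ => hMT.mp_thm hβ (RG_weaken _ _)) (hMT.thm (RG_imp_self α)))
  refine ⟨M, hTM, hMT, hM.prop.2, fun α β => ?_⟩
  by_contra! hno
  exact hM.prop.2 (hMT.mp (hMT.mp_thm (hout _ hno.1) (RG_prelinear α β φ)) (hout _ hno.2))

/-- The consequences of a set of formulas in an extension of rational Gödel logic form a
theory. -/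
theorem isTheory_consequences {L : Logic UnitRat} (hL : L.IsExtensionOf RG)
    (Γ : Set (Fm UnitRat)) : IsTheory {φ | L.Entails Γ φ} := by
  refine ⟨fun {φ} h => L.cut (Δ := ∅) (by simp) (hL _ _ h), fun {α β} h h' => ?_⟩
  refine L.cut (Δ := {.imp α β, α}) (by rintro ψ (rfl | rfl); exacts [h, h']) (hL _ _ ?_)
  refine RG_entails (by simp) fun A hA v hv => ?_
  have h1 := hv (.imp α β) (by simp)
  have h2 := hv α (by simp)
  have h3 : A.imp (α.eval A v) (β.eval A v) = A.one := h1
  rwa [h2, GA_one_imp hA.1] at h3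

/-- The theorems of `L` hold in the chain. -/
def ModelsThms (L : Logic UnitRat) {X : Type} [LinearOrder X] (bot top : X) (k : UnitRat → X) :
    Prop :=
  ∀ φ, L.IsTheorem φ → ∀ w : ℕ → X, cev bot top k w φ = top

/-- Completeness of extensions of rational Gödel logic with respect to chains. -/
theorem exists_chain_of_not_entails {L : Logic UnitRat} (hL : L.IsExtensionOf RG)
    {Γ : Set (Fm UnitRat)} {φ : Fm UnitRat} (h : ¬ L.Entails Γ φ) :
    ∃ (X : Type) (_ : LinearOrder X) (bot top : X) (k : UnitRat → X), RGChain X bot top k ∧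
      ModelsThms L bot top k ∧ ∃ v : ℕ → X, (∀ γ ∈ Γ, cev bot top k v γ = top) ∧
        cev bot top k v φ ≠ top := by
  -- The linear theory `T` need not be closed under the rules of `L`, only under those of rational
  -- Gödel logic. The resulting chain therefore satisfies the theorems of `L`, but possibly not its
  -- rules.
  obtain ⟨T, hΓT, hT, hφ, hlin⟩ := (isTheory_consequences hL Γ).exists_linear h
  have hchain : IsChainRGA (lind hT) := by
    refine ⟨lind_mem_RGA hT, fun a b => ?_⟩
    induction a using Quotient.inductionOn
    induction b using Quotient.inductionOn
    rename_i α β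
    exact (hlin α β).imp
      (fun h => (GA_imp_eq_one_iff (lind_mem_RGA hT).1).1 ((lindMk_eq_one hT).2 h))
      (fun h => (GA_imp_eq_one_iff (lind_mem_RGA hT).1).1 ((lindMk_eq_one hT).2 h))
  have hmod : ∀ ψ, L.IsTheorem ψ → ∀ w, ψ.eval (lind hT) w = (lind hT).one := by
    intro ψ hψ w
    obtain ⟨σ, rfl⟩ := exists_lindMk_comp hT w
    rw [lind_eval, lindMk_eq_one]
    refine hΓT (L.cut (Δ := ∅) (by simp) ?_)
    simpa using L.substitution σ hψ
  have hev : ∀ ψ : Fm UnitRat,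
      ψ.eval (lind hT) (fun n => lindMk hT (.var n)) = (lind hT).one ↔ ψ ∈ T := by
    intro ψ
    rw [lind_eval, lindMk_eq_one, Tm.subst_var]
  have hfin : ∃ v, (∀ γ ∈ Γ, γ.eval (lind hT) v = (lind hT).one) ∧
      φ.eval (lind hT) v ≠ (lind hT).one :=
    ⟨_, fun γ hγ => (hev γ).2 (hΓT (L.reflexive hγ)), fun h => hφ ((hev φ).1 h)⟩
  generalize lind hT = B at hchain hmod hfin
  obtain ⟨X, lo, bot, top, k, hX, rfl⟩ := hchain.exists_eq
  exact ⟨X, lo, bot, top, k, hX, hmod, hfin⟩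

/-! ### The canonical chain of an extension of rational Gödel logic -/

/-- The formula that is not valid in a chain in which `c_p` is not `1` iff there are at least
`n + 1` elements strictly between `c_p` and `1`. -/
def chainFm (p : UnitRat) : ℕ → Fm UnitRat
  | 0 => .sup (.var 0) (.imp (.var 0) (.cst p))
  | n + 1 => .sup (.var (n + 1)) (.imp (.var (n + 1)) (chainFm p n))

/-- `p` is the greatest index such that `c_p` is not a theorem. -/
def IsMaxConst (L : Logic UnitRat) (p : UnitRat) : Prop :=
  ¬ L.IsTheorem (.cst p) ∧ ∀ q, ¬ L.IsTheorem (.cst q) → q ≤ p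

/-- The chains that represent an extension of rational Gödel logic: the elements are the
interpretations of the constants, those constants become `1` that are theorems, and above the
greatest other constant, if there is one, there is a sequence of further elements, as many as
`L` permits. -/
structure IsCanonical (L : Logic UnitRat) {X : Type} [LinearOrder X] (bot top : X)
    (k : UnitRat → X) (t : ℕ → X) : Prop where
  chain : RGChain X bot top k
  cst_iff : ∀ q, k q = top ↔ L.IsTheorem (.cst q)
  cases : ∀ a, (∃ q, a = k q) ∨ ∃ p n, IsMaxConst L p ∧ ¬ L.IsTheorem (chainFm p n) ∧ a = t n
  t_lt : ∀ {p n}, IsMaxConst L p → ¬ L.IsTheorem (chainFm p n) → t n < top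
  lt_t : ∀ {p n}, IsMaxConst L p → ¬ L.IsTheorem (chainFm p n) → k p < t n
  t_lt_t : ∀ {p n m}, IsMaxConst L p → n < m → ¬ L.IsTheorem (chainFm p m) → t n < t m

/-! ### Values of the formulas that count elements above `c_p` -/

section chainFm
variable {X : Type} [LinearOrder X] {bot top : X} {k : UnitRat → X}

/-- The device behind `chainFm`: each layer moves strictly upwards or reaches the greatest element.
-/
theorem cev_sup_imp {s t : Fm UnitRat} {w : ℕ → X} (h : RGChain X bot top k) :
    cev bot top k w (.sup s (.imp s t)) =
      if cev bot top k w s ≤ cev bot top k w t then top else cev bot top k w s := by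
  have : cev bot top k w (.sup s (.imp s t)) =
    max (cev bot top k w s) (godelImp top (cev bot top k w s) (cev bot top k w t)) := rfl
  rw [this, godelImp]
  split_ifs with hle
  · exact max_eq_right (h.le_top _)
  · exact max_eq_left (le_of_not_ge hle)

theorem lt_cev_chainFm (h : RGChain X bot top k) (p : UnitRat) (w : ℕ → X) (n : ℕ) :
    k p < cev bot top k w (chainFm p n) ∨ cev bot top k w (chainFm p n) = top := by
  induction n with
  | zero =>
    rw [chainFm, cev_sup_imp h]
    split_ifs with hle
    · exact Or.inr rfl
    · exact Or.inl (lt_of_not_ge hle)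
  | succ n ih =>
    rw [chainFm, cev_sup_imp h]
    split_ifs with hle
    · exact Or.inr rfl
    · rcases ih with ih | ih
      · exact Or.inl (ih.trans (lt_of_not_ge hle))
      · exact (hle (by rw [ih]; exact h.le_top _)).elim

theorem cev_chainFm_succ (h : RGChain X bot top k) (p : UnitRat) (w : ℕ → X) (n : ℕ) :
    cev bot top k w (chainFm p n) < cev bot top k w (chainFm p (n + 1)) ∨
      cev bot top k w (chainFm p (n + 1)) = top := by
  rw [chainFm, cev_sup_imp h]
  split_ifs with hle
  · exact Or.inr rfl
  · exact Or.inl (lt_of_not_ge hle)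

theorem cev_chainFm_lt (h : RGChain X bot top k) (p : UnitRat) (w : ℕ → X) {n m : ℕ}
    (hnm : n < m) :
    cev bot top k w (chainFm p n) < cev bot top k w (chainFm p m) ∨
      cev bot top k w (chainFm p m) = top := by
  induction m, hnm using Nat.le_induction with
  | base => exact cev_chainFm_succ h p w n
  | succ m _ ih =>
    rcases cev_chainFm_succ h p w m with h1 | h1
    · rcases ih with ih | ih
      · exact Or.inl (ih.trans h1)
      · exact absurd (h.le_top _) (ih ▸ h1).not_ge
    · exact Or.inr h1

theorem cev_chainFm_of_lt (h : RGChain X bot top k) (p : UnitRat) (w : ℕ → X) (n : ℕ)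
    (h0 : k p < w 0) (hs : ∀ i < n, w i < w (i + 1)) : cev bot top k w (chainFm p n) = w n := by
  induction n with
  | zero =>
    rw [chainFm, cev_sup_imp h]
    exact if_neg h0.not_ge
  | succ n ih =>
    rw [chainFm, cev_sup_imp h, ih fun i hi => hs i (hi.trans n.lt_succ_self)]
    exact if_neg (hs n n.lt_succ_self).not_ge

end chainFm

/-- The formula for `n` follows from that for smaller numbers. -/
theorem isTheorem_chainFm_mono {L : Logic UnitRat} (hL : L.IsExtensionOf RG) {p : UnitRat}
    {n m : ℕ} (hnm : n ≤ m) (h : L.IsTheorem (chainFm p n)) : L.IsTheorem (chainFm p m) := by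
  by_contra hno
  obtain ⟨X, _, bot, top, k, hX, hmod, v, -, hv⟩ := exists_chain_of_not_entails hL hno
  rcases hnm.eq_or_lt with rfl | hlt
  · exact hno h
  · rcases cev_chainFm_lt hX p v hlt with h1 | h1
    · rw [hmod _ h] at h1
      exact h1.not_ge (hX.le_top _)
    · exact hv h1

/-! ### Representing formulas and validity of admissible rules -/

section canonical
variable {L : Logic UnitRat} {X Y : Type} [LinearOrder X] [LinearOrder Y] {bot top : X}
  {k : UnitRat → X} {t : ℕ → X} {bot' top' : Y} {k' : UnitRat → Y}

/-- The formula `τ` represents the element `a` of the canonical chain. -/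
def Represents (L : Logic UnitRat) (k : UnitRat → X) (t : ℕ → X) (a : X) (τ : Fm UnitRat) :
    Prop :=
  (∃ q, a = k q ∧ τ = .cst q) ∨
    ∃ p n, IsMaxConst L p ∧ ¬ L.IsTheorem (chainFm p n) ∧ a = t n ∧ τ = chainFm p n

theorem IsCanonical.exists_represents (hA : IsCanonical L bot top k t) (a : X) :
    ∃ τ, Represents L k t a τ := by
  rcases hA.cases a with ⟨q, h⟩ | ⟨p, n, hp, hn, h⟩
  · exact ⟨_, Or.inl ⟨q, h, rfl⟩⟩
  · exact ⟨_, Or.inr ⟨p, n, hp, hn, h, rfl⟩⟩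

theorem IsMaxConst.unique {p q : UnitRat} (hp : IsMaxConst L p) (hq : IsMaxConst L q) : p = q :=
  le_antisymm (hq.2 _ hp.1) (hp.2 _ hq.1)

theorem ModelsThms.cst (hC : ModelsThms L bot' top' k') {q : UnitRat}
    (h : L.IsTheorem (.cst q)) : k' q = top' :=
  hC _ h fun _ => top'

/-- The two conclusions are the hypotheses of `eval_rel` for the relation between an element of the
canonical chain and the value of a formula representing it. For constants the order is that of the
rationals, and the layers of `chainFm` supply the strict steps above `c_p`. -/
theorem IsCanonical.represents_mono (hA : IsCanonical L bot top k t)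
    (hB : RGChain Y bot' top' k') (hC : ModelsThms L bot' top' k') (w : ℕ → Y) {a a' : X}
    {τ τ' : Fm UnitRat} (h : Represents L k t a τ) (h' : Represents L k t a' τ') (hle : a ≤ a') :
    cev bot' top' k' w τ ≤ cev bot' top' k' w τ' ∧
      (a < a' → cev bot' top' k' w τ < cev bot' top' k' w τ' ∨ cev bot' top' k' w τ = top') := by
  rcases h with ⟨q, rfl, rfl⟩ | ⟨p, n, hp, hn, rfl, rfl⟩ <;>
    rcases h' with ⟨q', rfl, rfl⟩ | ⟨p', m, hp', hm, rfl, rfl⟩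
  · change k' q ≤ k' q' ∧ (k q < k q' → k' q < k' q' ∨ k' q = top')
    rcases lt_or_ge q' q with hq | hq
    -- Order reversed among indices can only come from collapsed constants: both are 1 in the
    -- canonical chain, hence theorems.
    · have h1 := hA.chain.eq_top hq hle
      have h2 : k q = top := le_antisymm (hA.chain.le_top _) (h1 ▸ hA.chain.mono hq.le)
      rw [hC.cst ((hA.cst_iff q).1 h2), hC.cst ((hA.cst_iff q').1 h1)]
      simp
    · refine ⟨hB.mono hq, fun hlt => ?_⟩
      have hq' : q < q' := lt_of_le_of_ne hq (by rintro rfl; exact hlt.false)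
      by_contra! hno
      exact hno.2 (hB.eq_top hq' hno.1)
  · have hq : q ≤ p' := hp'.2 q fun hth =>
      ((hA.t_lt hp' hm).trans_le ((hA.cst_iff q).2 hth ▸ hle)).false
    change k' q ≤ _ ∧ (_ → k' q < _ ∨ k' q = top')
    rcases lt_cev_chainFm hB p' w m with h1 | h1
    · have := (hB.mono hq).trans_lt h1
      exact ⟨this.le, fun _ => Or.inl this⟩
    · rw [h1]
      exact ⟨hB.le_top _, fun _ => lt_or_eq_of_le (hB.le_top _)⟩
  · have hq : L.IsTheorem (.cst q') := by
      by_contra hno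
      exact ((hA.lt_t hp hn).trans_le hle).not_ge (hA.chain.mono (hp.2 _ hno))
    change _ ≤ k' q' ∧ (_ → _ < k' q' ∨ _)
    rw [hC.cst hq]
    exact ⟨hB.le_top _, fun _ => lt_or_eq_of_le (hB.le_top _)⟩
  · obtain rfl := hp.unique hp'
    rcases lt_trichotomy n m with hnm | rfl | hnm
    · rcases cev_chainFm_lt hB p w hnm with h1 | h1
      · exact ⟨h1.le, fun _ => Or.inl h1⟩
      · rw [h1]
        exact ⟨hB.le_top _, fun _ => lt_or_eq_of_le (hB.le_top _)⟩
    · exact ⟨le_rfl, fun h => (h.false).elim⟩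
    · exact absurd (hA.t_lt_t hp hnm hn) hle.not_gt

/-- The rule `Γ ▷ φ` is valid in the chain. -/
def ChainValid (bot top : X) (k : UnitRat → X) (Γ : Set (Fm UnitRat)) (φ : Fm UnitRat) : Prop :=
  ∀ v : ℕ → X, (∀ γ ∈ Γ, cev bot top k v γ = top) → cev bot top k v φ = top

theorem cev_subst (w : ℕ → X) (σ : ℕ → Fm UnitRat) (φ : Fm UnitRat) :
    cev bot top k w (φ.subst σ) = cev bot top k (fun x => cev bot top k w (σ x)) φ :=
  Tm.eval_subst _ _ _ _

/-- Admissible rules are valid in the canonical chain. -/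
theorem IsCanonical.chainValid_of_admissible (hL : L.IsExtensionOf RG)
    (hA : IsCanonical L bot top k t) {Γ : Set (Fm UnitRat)} {φ : Fm UnitRat}
    (h : L.Admissible Γ φ) : ChainValid bot top k Γ φ := by
  intro v hv
  choose σ hσ using fun x => hA.exists_represents (v x)
  obtain ⟨τ, hτ⟩ := hA.exists_represents (cev bot top k v φ)
  -- In every chain satisfying the theorems of `L`, the substitution instance `ψ.subst σ` takes the
  -- value of a formula representing the value of `ψ` under `v`.
  have key : ∀ {Y : Type} [LinearOrder Y] {bot' top' : Y} {k' : UnitRat → Y},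
      RGChain Y bot' top' k' → ModelsThms L bot' top' k' → ∀ (w : ℕ → Y) (ψ : Fm UnitRat),
      ∃ ρ, Represents L k t (cev bot top k v ψ) ρ ∧
        cev bot' top' k' w (ψ.subst σ) = cev bot' top' k' w ρ := by
    intro Y _ bot' top' k' hB hC w ψ
    rw [cev_subst]
    refine eval_rel (R := fun a b => ∃ ρ, Represents L k t a ρ ∧ b = cev bot' top' k' w ρ)
      ?_ ?_ hB.le_top ⟨.cst 0, Or.inl ⟨0, hA.chain.zero.symm, rfl⟩, hB.zero.symm⟩
      ⟨.cst 1, Or.inl ⟨1, hA.chain.one.symm, rfl⟩, hB.one.symm⟩ ψ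
      (fun x _ => ⟨σ x, hσ x, rfl⟩) (fun c _ => ⟨.cst c, Or.inl ⟨c, rfl, rfl⟩, rfl⟩)
    · rintro a _ a' _ ⟨ρ, hρ, rfl⟩ ⟨ρ', hρ', rfl⟩ hle
      exact (hA.represents_mono hB hC w hρ hρ' hle).1
    · rintro a _ a' _ ⟨ρ, hρ, rfl⟩ ⟨ρ', hρ', rfl⟩ hlt
      exact (hA.represents_mono hB hC w hρ hρ' hlt.le).2 hlt
  have hφ : L.IsTheorem (φ.subst σ) := by
    refine h σ fun γ hγ => ?_
    by_contra hno
    obtain ⟨Y, _, bot', top', k', hB, hC, w, -, hw⟩ := exists_chain_of_not_entails hL hno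
    obtain ⟨ρ, hρ, he⟩ := key hB hC w γ
    rw [hv γ hγ] at hρ
    have h1 := (hA.represents_mono hB hC w (Or.inl ⟨1, hA.chain.one.symm, rfl⟩) hρ le_rfl).1
    change k' 1 ≤ _ at h1
    rw [hB.one] at h1
    exact hw (he.trans (le_antisymm (hB.le_top _) h1))
  -- The formulas `ρ` and `τ` represent the same element, so the value of `τ` is at least that of
  -- the theorem `φ.subst σ`.
  have hth : L.IsTheorem τ := by
    by_contra hno
    obtain ⟨Y, _, bot', top', k', hB, hC, w, -, hw⟩ := exists_chain_of_not_entails hL hno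
    obtain ⟨ρ, hρ, he⟩ := key hB hC w φ
    rw [hC _ hφ] at he
    have h1 := (hA.represents_mono hB hC w hρ hτ le_rfl).1
    rw [← he] at h1
    exact hw (le_antisymm (hB.le_top _) h1)
  rcases hτ with ⟨q, hq, rfl⟩ | ⟨p, n, hp, hn, -, rfl⟩
  · rw [hq, hA.cst_iff]; exact hth
  · exact absurd hth hn

end canonical

/-! ### Embedding finite parts of chains into the canonical chain -/

section embedding
variable {L : Logic UnitRat} {X Y : Type} [LinearOrder X] [LinearOrder Y] {bot top : X}
  {k : UnitRat → X} {t : ℕ → X} {bot' top' : Y} {k' : UnitRat → Y}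

/-- Extends the map that fixes the uncollapsed constants in `F` and sends the greatest element to
`M`. For `M > 1` the rational values may leave the unit interval and are truncated, so strictness is
claimed only below some constant in `F`. -/
theorem RGChain.exists_rat_map (hB : RGChain Y bot' top' k') (F : Finset UnitRat)
    (hF : ∀ c ∈ F, k' c ≠ top') (h0 : 0 ∈ F) (M : ℚ) (hM : ∀ c ∈ F, (c : ℚ) < M) (U : Finset Y) :
    ∃ g : Y → UnitRat, (∀ c ∈ F, g (k' c) = c) ∧
      (∀ u ∈ U, u ≠ top' → M ≤ 1 → (g u : ℚ) < M) ∧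
      (∀ u ∈ U, ∀ c ∈ F, u ≤ k' c → g u ≤ c) ∧
      (∀ u ∈ U, ∀ u' ∈ U, u < u' → u' ≠ top' → (M ≤ 1 ∨ ∃ c ∈ F, u' ≤ k' c) → g u < g u') := by
  classical
  let g₀ : Y → ℚ := fun y => if y = top' then M else (Function.invFun k' y : UnitRat)
  have hinv : ∀ c ∈ F, Function.invFun k' (k' c) = c := fun c hc =>
    (hB.inj (hF c hc) (Function.invFun_eq ⟨c, rfl⟩).symm).symm
  have hg₀ : ∀ c ∈ F, g₀ (k' c) = c := fun c hc => by simp [g₀, hF c hc, hinv c hc]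
  obtain ⟨g, hg, hgV⟩ := exists_strictMonoOn_extension (insert top' (F.image k')) U g₀ (by
    intro a ha b hb hab
    simp only [Finset.coe_insert, Finset.coe_image, Set.mem_insert_iff, Set.mem_image,
      Finset.mem_coe] at ha hb
    rcases ha with rfl | ⟨c, hc, rfl⟩
    · exact absurd (hB.le_top b) hab.not_ge
    rw [hg₀ c hc]
    rcases hb with rfl | ⟨c', hc', rfl⟩
    · simpa [g₀] using hM c hc
    · rw [hg₀ c' hc']
      exact_mod_cast (hB.lt_iff (hF c hc)).1 hab)
  have hgF : ∀ c ∈ F, g (k' c) = c := fun c hc =>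
    (hgV _ (Finset.mem_insert_of_mem (Finset.mem_image_of_mem _ hc))).trans (hg₀ c hc)
  have hgtop : g top' = M := (hgV _ (Finset.mem_insert_self _ _)).trans (by simp [g₀])
  have mU : ∀ u ∈ U, u ∈ (↑(U ∪ insert top' (F.image k')) : Set Y) := fun u hu => by simp [hu]
  have mF : ∀ c ∈ F, k' c ∈ (↑(U ∪ insert top' (F.image k')) : Set Y) := fun c hc => by
    simp only [Finset.coe_union, Finset.coe_insert, Finset.coe_image]
    exact Or.inr (Or.inr ⟨c, hc, rfl⟩)
  have mT : top' ∈ (↑(U ∪ insert top' (F.image k')) : Set Y) := by simp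
  have hg0 : ∀ u ∈ U, 0 ≤ g u := fun u hu => by
    have := hg.monotoneOn (mF 0 h0) (mU u hu) (hB.zero ▸ hB.bot_le u)
    rw [hgF 0 h0] at this
    exact this
  have hgM : ∀ u ∈ U, u ≠ top' → g u < M := fun u hu hne =>
    hgtop ▸ hg (mU u hu) mT (lt_of_le_of_ne (hB.le_top u) hne)
  have hgc : ∀ u ∈ U, ∀ c ∈ F, u ≤ k' c → g u ≤ c := fun u hu c hc hle =>
    hgF c hc ▸ hg.monotoneOn (mU u hu) (mF c hc) hle
  have hcoe : ∀ q : ℚ, 0 ≤ q → q ≤ 1 → (Set.projIcc 0 1 zero_le_one q : ℚ) = q :=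
    fun q hq hq' => by rw [Set.projIcc_of_mem _ ⟨hq, hq'⟩]
  refine ⟨fun y => Set.projIcc 0 1 zero_le_one (g y), fun c hc => ?_, fun u hu hne hM1 => ?_,
    fun u hu c hc hle => ?_, fun u hu u' hu' hlt hne hor => ?_⟩
  · simp only [hgF c hc, Set.projIcc_val]
  · have := hgM u hu hne
    rw [hcoe _ (hg0 u hu) (this.le.trans hM1)]
    exact this
  · have := hgc u hu c hc hle
    rw [← Subtype.coe_le_coe, hcoe _ (hg0 u hu) (this.trans c.2.2)]
    exact this
  · have h1 := hg (mU u hu) (mU u' hu') hlt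
    have h2 : g u' ≤ 1 := by
      rcases hor with hM1 | ⟨c, hc, hle⟩
      · exact (hgM u' hu' hne).le.trans hM1
      · exact (hgc u' hu' c hc hle).trans c.2.2
    rw [← Subtype.coe_lt_coe, hcoe _ (hg0 u hu) (h1.le.trans h2), hcoe _ (hg0 u' hu') h2]
    exact h1

/-- Counting elements above `c_p` in a chain that satisfies the theorems of `L`. -/
theorem ModelsThms.not_isTheorem_chainFm (hB : RGChain Y bot' top' k')
    (hC : ModelsThms L bot' top' k') {p : UnitRat} (U : Finset Y) {u : Y} (hp : k' p < u)
    (hu : u ≠ top') :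
    ¬ L.IsTheorem (chainFm p (U.filter fun y => k' p < y ∧ y < u).card) := by
  intro hth
  set V := U.filter fun y => k' p < y ∧ y < u with hV
  have huV : u ∉ V := by simp [hV]
  have hcard : (insert u V).card = V.card + 1 := Finset.card_insert_of_notMem huV
  let e := (insert u V).orderEmbOfFin hcard
  have hmem : ∀ y ∈ insert u V, k' p < y ∧ y ≤ u := by
    intro y hy
    rcases Finset.mem_insert.1 hy with rfl | hy
    · exact ⟨hp, le_rfl⟩
    · exact ⟨(Finset.mem_filter.1 hy).2.1, (Finset.mem_filter.1 hy).2.2.le⟩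
  -- The increasing enumeration of `V` and `u`. `Fin.ofNat` wraps around, but strict increase is
  -- needed only for indices up to `V.card`.
  let w : ℕ → Y := fun i => e (Fin.ofNat (V.card + 1) i)
  have hw : ∀ i, k' p < w i ∧ w i ≤ u := fun i => hmem _ (Finset.orderEmbOfFin_mem _ _ _)
  have h1 := cev_chainFm_of_lt hB p w V.card (hw 0).1 (by
    intro i hi
    refine e.strictMono ?_
    rw [Fin.lt_def]
    simp only [Fin.ofNat]
    rw [Nat.mod_eq_of_lt (by omega), Nat.mod_eq_of_lt (by omega)]
    omega)
  rw [hC _ hth] at h1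
  exact hu (le_antisymm (hB.le_top _) (h1 ▸ (hw _).2))

/-- The question is what room there is above the greatest uncollapsed constant `c_m` in use. If `m`
is the greatest index of a non-theorem, the elements `t_n` provide the room, and counting shows that
there are enough of them; otherwise the constants between `c_m` and a larger non-theorem do. The
last clause concerns constants that collapse in `Y` but perhaps not in `X`. -/
theorem IsCanonical.exists_embedding (hA : IsCanonical L bot top k t)
    (hB : RGChain Y bot' top' k') (hC : ModelsThms L bot' top' k') (hne : bot' ≠ top')
    (F : Finset UnitRat) (U : Finset Y) :
    ∃ h : Y → X, h top' = top ∧ (∀ u ∈ U, u ≠ top' → h u < top) ∧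
      (∀ u ∈ U, ∀ u' ∈ U, u < u' → h u < h u') ∧
      (∀ c ∈ F, k' c ≠ top' → h (k' c) = k c) ∧
      ∀ u ∈ U, u ≠ top' → ∀ c ∈ F, k' c = top' → h u < k c := by
  classical
  have hnt : ∀ {c}, k' c ≠ top' → ¬ L.IsTheorem (.cst c) := fun hc hth => hc (hC.cst hth)
  have hle : ∀ {c d}, c ≤ d → ¬ L.IsTheorem (.cst d) → ¬ L.IsTheorem (.cst c) := by
    intro c d hcd hd hc
    rw [← hA.cst_iff] at hc hd
    exact hd (le_antisymm (hA.chain.le_top _) (hc ▸ hA.chain.mono hcd))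
  set F₀ := (insert 0 F).filter fun c => k' c ≠ top' with hF₀
  have h0 : 0 ∈ F₀ := by simp [hF₀, hB.zero, hne]
  have hF₀top : ∀ c ∈ F₀, k' c ≠ top' := fun c hc => (Finset.mem_filter.1 hc).2
  have hF₀F : ∀ c ∈ F, k' c ≠ top' → c ∈ F₀ := fun c hc hc' => by simp [hF₀, hc, hc']
  set m := F₀.max' ⟨0, h0⟩ with hm
  have hmF : m ∈ F₀ := F₀.max'_mem _
  have hmmax : ∀ c ∈ F₀, c ≤ m := fun c hc => F₀.le_max' c hc
  have hmlt : ∀ c, k' c = top' → m < c := fun c hc => lt_of_not_ge fun hle =>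
    hF₀top m hmF (le_antisymm (hB.le_top _) (hc ▸ hB.mono hle))
  by_cases hmax : IsMaxConst L m
  -- Any bound above 1 would do, since `g` is used only on elements below `c_m`.
  · obtain ⟨g, hgF, -, hgle, hglt⟩ := hB.exists_rat_map F₀ hF₀top h0 2
      (fun c _ => lt_of_le_of_lt c.2.2 (by norm_num)) U
    have hth : ∀ {u}, u ≠ top' → ¬ u ≤ k' m →
        ¬ L.IsTheorem (chainFm m (U.filter fun y => k' m < y ∧ y < u).card) := fun hu hle =>
      hC.not_isTheorem_chainFm hB U (lt_of_not_ge hle) hu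
    -- An element above `c_m` goes to `t_n`, where `n` counts the elements of `U` strictly between;
    -- so the lowest one goes to `t_0`.
    let h : Y → X := fun u => if u = top' then top else if u ≤ k' m then k (g u) else
      t (U.filter fun y => k' m < y ∧ y < u).card
    have hlow : ∀ {u}, u ≠ top' → u ≤ k' m → h u = k (g u) := fun h1 h2 => by simp [h, h1, h2]
    have hhigh : ∀ {u}, u ≠ top' → ¬ u ≤ k' m →
        h u = t (U.filter fun y => k' m < y ∧ y < u).card := fun h1 h2 => by simp [h, h1, h2]
    have hktop : ∀ {c}, c ≤ m → k c ≠ top := fun hc he =>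
      hle hc hmax.1 ((hA.cst_iff _).1 he)
    have hlttop : ∀ u ∈ U, u ≠ top' → h u < top := by
      intro u hu hut
      by_cases hum : u ≤ k' m
      · rw [hlow hut hum]
        exact lt_of_le_of_ne (hA.chain.le_top _) (hktop (hgle u hu m hmF hum))
      · rw [hhigh hut hum]
        exact hA.t_lt hmax (hth hut hum)
    refine ⟨h, by simp [h], hlttop, fun u hu u' hu' hlt => ?_, fun c hc hct => ?_,
      fun u hu hut c _ hct => ?_⟩
    · have hut : u ≠ top' := fun he => (hlt.trans_le (he ▸ hB.le_top u')).false
      by_cases hut' : u' = top'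
      · have : h u' = top := by simp [h, hut']
        rw [this]
        exact hlttop u hu hut
      by_cases hum' : u' ≤ k' m
      · rw [hlow hut (hlt.le.trans hum'), hlow hut' hum']
        exact hA.chain.lt (hglt u hu u' hu' hlt hut' (Or.inr ⟨m, hmF, hum'⟩))
          (hktop (hgle u hu m hmF (hlt.le.trans hum')))
      · rw [hhigh hut' hum']
        by_cases hum : u ≤ k' m
        · rw [hlow hut hum]
          exact (hA.chain.mono (hgle u hu m hmF hum)).trans_lt (hA.lt_t hmax (hth hut' hum'))
        · rw [hhigh hut hum]
          refine hA.t_lt_t hmax (Finset.card_lt_card ?_) (hth hut' hum')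
          refine ⟨fun y hy => ?_, fun hsub => ?_⟩
          · rw [Finset.mem_filter] at hy ⊢
            exact ⟨hy.1, hy.2.1, hy.2.2.trans hlt⟩
          · have := hsub (Finset.mem_filter.2 ⟨hu, lt_of_not_ge hum, hlt⟩)
            exact (Finset.mem_filter.1 this).2.2.false
    · rw [hlow hct (hB.mono (hmmax c (hF₀F c hc hct))), hgF c (hF₀F c hc hct)]
    · have : k c = top := (hA.cst_iff c).2 (by
        by_contra hno
        exact (hmlt c hct).not_ge (hmax.2 c hno))
      rw [this]
      exact hlttop u hu hut
  · have hex : ∃ q, ¬ L.IsTheorem (.cst q) ∧ m < q := by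
      by_contra! hno
      exact hmax ⟨hnt (hF₀top m hmF), hno⟩
    obtain ⟨q, hq, hmq⟩ := hex
    -- Values below `M` stay below the non-theorem `c_q`, hence are not collapsed in `X`, and below
    -- all constants in `F` that collapse in `Y`.
    set M := (insert q (F.filter fun c => k' c = top')).min' ⟨q, Finset.mem_insert_self _ _⟩
      with hM
    have hMq : M ≤ q := Finset.min'_le _ _ (Finset.mem_insert_self _ _)
    have hMc : ∀ c ∈ F, k' c = top' → M ≤ c := fun c hc hct =>
      Finset.min'_le _ _ (Finset.mem_insert_of_mem (Finset.mem_filter.2 ⟨hc, hct⟩))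
    have hmM : m < M := by
      have hmem := Finset.min'_mem (insert q (F.filter fun c => k' c = top'))
        ⟨q, Finset.mem_insert_self _ _⟩
      rw [← hM] at hmem
      rcases Finset.mem_insert.1 hmem with h | h
      · exact h ▸ hmq
      · exact hmlt _ (Finset.mem_filter.1 h).2
    obtain ⟨g, hgF, hgM, -, hglt⟩ := hB.exists_rat_map F₀ hF₀top h0 M
      (fun c hc => (hmmax c hc).trans_lt hmM) U
    have hgM' : ∀ u ∈ U, u ≠ top' → g u < M := fun u hu hut => hgM u hu hut M.2.2
    let h : Y → X := fun u => if u = top' then top else k (g u)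
    have hh : ∀ {u}, u ≠ top' → h u = k (g u) := fun h1 => by simp [h, h1]
    have hktop : ∀ u ∈ U, u ≠ top' → k (g u) ≠ top := fun u hu hut he =>
      hle ((hgM' u hu hut).le.trans hMq) hq ((hA.cst_iff _).1 he)
    have hlttop : ∀ u ∈ U, u ≠ top' → h u < top := fun u hu hut =>
      hh hut ▸ lt_of_le_of_ne (hA.chain.le_top _) (hktop u hu hut)
    refine ⟨h, by simp [h], hlttop, fun u hu u' hu' hlt => ?_, fun c hc hct => ?_,
      fun u hu hut c hc hct => ?_⟩
    · have hut : u ≠ top' := fun he => (hlt.trans_le (he ▸ hB.le_top u')).false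
      by_cases hut' : u' = top'
      · have : h u' = top := by simp [h, hut']
        rw [this]
        exact hlttop u hu hut
      · rw [hh hut, hh hut']
        exact hA.chain.lt (hglt u hu u' hu' hlt hut' (Or.inl M.2.2)) (hktop u hu hut)
    · rw [hh hct, hgF c (hF₀F c hc hct)]
    · rw [hh hut]
      exact hA.chain.lt ((hgM' u hu hut).trans_le (hMc c hc hct)) (hktop u hu hut)

end embedding

/-! ### Rules valid in the canonical chain -/

section rules
variable {L : Logic UnitRat} {X Y : Type} [LinearOrder X] [LinearOrder Y] {bot top : X}
  {k : UnitRat → X} {t : ℕ → X} {bot' top' : Y} {k' : UnitRat → Y}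

/-- A finite part of a chain that contains all values of the given formulas, with an embedding
into the canonical chain. -/
theorem IsCanonical.exists_embedding_values (hA : IsCanonical L bot top k t)
    (hB : RGChain Y bot' top' k') (hC : ModelsThms L bot' top' k') (hne : bot' ≠ top')
    {G : Set (Fm UnitRat)} (hG : G.Finite) (v : ℕ → Y) :
    ∃ (U : Finset Y) (h : Y → X), bot' ∈ U ∧ top' ∈ U ∧ (∀ γ ∈ G, ∀ x ∈ γ.vars, v x ∈ U) ∧
      (∀ γ ∈ G, ∀ c ∈ γ.csts, k' c ∈ U) ∧ h bot' = bot ∧ h top' = top ∧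
      (∀ u ∈ U, u ≠ top' → h u < top) ∧ (∀ u ∈ U, ∀ u' ∈ U, u < u' → h u < h u') ∧
      (∀ γ ∈ G, ∀ c ∈ γ.csts, k' c ≠ top' → h (k' c) = k c) ∧
      ∀ u ∈ U, u ≠ top' → ∀ γ ∈ G, ∀ c ∈ γ.csts, k' c = top' → h u < k c := by
  classical
  let F : Finset UnitRat := insert 0 (hG.toFinset.biUnion fun γ => γ.csts.toFinset)
  let U : Finset Y := insert bot' (insert top' (F.image k' ∪
    hG.toFinset.biUnion fun γ => (γ.vars.map v).toFinset))
  have hF : ∀ γ ∈ G, ∀ c ∈ γ.csts, c ∈ F := fun γ hγ c hc =>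
    Finset.mem_insert_of_mem
      (Finset.mem_biUnion.2 ⟨γ, hG.mem_toFinset.2 hγ, List.mem_toFinset.2 hc⟩)
  obtain ⟨h, h1, h2, h3, h4, h5⟩ := hA.exists_embedding hB hC hne F U
  refine ⟨U, h, Finset.mem_insert_self _ _,
    Finset.mem_insert_of_mem (Finset.mem_insert_self _ _), fun γ hγ x hx => ?_,
    fun γ hγ c hc => ?_, ?_, h1, h2, h3, fun γ hγ c hc => h4 c (hF γ hγ c hc),
    fun u hu hut γ hγ c hc => h5 u hu hut c (hF γ hγ c hc)⟩
  · exact Finset.mem_insert_of_mem (Finset.mem_insert_of_mem (Finset.mem_union_right _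
      (Finset.mem_biUnion.2 ⟨γ, hG.mem_toFinset.2 hγ, List.mem_toFinset.2
        (List.mem_map_of_mem hx)⟩)))
  · exact Finset.mem_insert_of_mem (Finset.mem_insert_of_mem (Finset.mem_union_left _
      (Finset.mem_image_of_mem _ (hF γ hγ c hc))))
  · have := h4 0 (Finset.mem_insert_self _ _) (hB.zero ▸ hne)
    rwa [hB.zero, hA.chain.zero] at this

theorem RGChain.bot_ne_top (hB : RGChain Y bot' top' k') {a : Y} (h : a ≠ top') : bot' ≠ top' :=
  fun he => h (le_antisymm (hB.le_top a) (he ▸ hB.bot_le a))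

/-- Formulas valid in the canonical chain are theorems. -/
theorem IsCanonical.isTheorem_of_chainValid (hL : L.IsExtensionOf RG)
    (hA : IsCanonical L bot top k t) {ψ : Fm UnitRat} (h : ChainValid bot top k ∅ ψ) :
    L.IsTheorem ψ := by
  by_contra hno
  obtain ⟨Y, _, bot', top', k', hB, hC, v, -, hv⟩ := exists_chain_of_not_entails hL hno
  obtain ⟨U, f, hbU, htU, hvU, hcU, hfb, hft, hlttop, hlt, hcst, hcst'⟩ :=
    hA.exists_embedding_values hB hC (hB.bot_ne_top hv) (Set.finite_singleton ψ) v
  -- A constant may be 1 in `Y` and not in `X`. So the greatest element of `Y` is related to every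
  -- element of `X` above the images of the other elements of `U`. This transfers the failure of a
  -- formula, but a premise with value 1 in `Y` may lose that value in `X`.
  have key := eval_rel (k := k) (k' := k') (bot := bot) (bot' := bot') (top := top)
    (R := fun a b => b ∈ U ∧ ((b ≠ top' ∧ a = f b) ∨ (b = top' ∧ ∀ u ∈ U, u ≠ top' → f u < a)))
    (v := f ∘ v) (w := v) ?_ ?_ hB.le_top ⟨hbU, Or.inl ⟨hB.bot_ne_top hv, hfb.symm⟩⟩
    ⟨htU, Or.inr ⟨rfl, hlttop⟩⟩ ψ (fun x hx => ?_) (fun c hc => ?_)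
  · rcases key with ⟨hU, ⟨-, h1⟩ | ⟨h1, -⟩⟩
    · have := hlttop _ hU hv
      rw [← h1, h _ (by simp)] at this
      exact this.false
    · exact hv h1
  · rintro a b a' b' ⟨hb, ⟨hbt, rfl⟩ | ⟨rfl, ha⟩⟩ ⟨hb', ⟨hbt', rfl⟩ | ⟨rfl, ha'⟩⟩ hle
    · exact le_of_not_gt fun hgt => (hlt _ hb' _ hb hgt).not_ge hle
    · exact hB.le_top _
    · exact absurd hle (ha _ hb' hbt').not_ge
    · exact le_rfl
  · rintro a b a' b' ⟨hb, ⟨hbt, rfl⟩ | ⟨rfl, ha⟩⟩ ⟨hb', ⟨hbt', rfl⟩ | ⟨rfl, ha'⟩⟩ hle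
    · refine Or.inl (lt_of_not_ge fun hge => ?_)
      rcases hge.eq_or_lt with rfl | hgt
      · exact hle.false
      · exact (hlt _ hb' _ hb hgt).not_gt hle
    · exact Or.inl (lt_of_le_of_ne (hB.le_top _) hbt)
    · exact Or.inr rfl
    · exact Or.inr rfl
  · refine ⟨hvU ψ rfl x hx, ?_⟩
    by_cases hxt : v x = top'
    · refine Or.inr ⟨hxt, fun u hu hut => ?_⟩
      rw [Function.comp, hxt, hft]
      exact hlttop u hu hut
    · exact Or.inl ⟨hxt, rfl⟩
  · refine ⟨hcU ψ rfl c hc, ?_⟩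
    by_cases hct : k' c = top'
    · exact Or.inr ⟨hct, fun u hu hut => hcst' u hu hut ψ rfl c hc hct⟩
    · exact Or.inl ⟨hct, (hcst ψ rfl c hc hct).symm⟩

/-- A rule that fails in a chain fails in the canonical chain, provided that no constant of the
rule is `1` in the first chain only. -/
theorem IsCanonical.not_chainValid (hA : IsCanonical L bot top k t)
    (hB : RGChain Y bot' top' k') (hC : ModelsThms L bot' top' k') {Γ : Set (Fm UnitRat)}
    (hΓ : Γ.Finite) {φ : Fm UnitRat} {v : ℕ → Y} (hv : ∀ γ ∈ Γ, cev bot' top' k' v γ = top')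
    (hφ : cev bot' top' k' v φ ≠ top')
    (hc : ∀ γ ∈ insert φ Γ, ∀ c ∈ γ.csts, k' c = top' → k c = top) :
    ¬ ChainValid bot top k Γ φ := by
  intro h
  obtain ⟨U, f, hbU, htU, hvU, hcU, hfb, hft, hlttop, hlt, hcst, -⟩ :=
    hA.exists_embedding_values hB hC (hB.bot_ne_top hφ) (hΓ.insert φ) v
  have key : ∀ γ ∈ insert φ Γ, cev bot' top' k' v γ ∈ U ∧
      cev bot top k (f ∘ v) γ = f (cev bot' top' k' v γ) := by
    intro γ hγ
    refine eval_rel (R := fun a b => b ∈ U ∧ a = f b) ?_ ?_ hB.le_top ⟨hbU, hfb.symm⟩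
      ⟨htU, hft.symm⟩ γ (fun x hx => ⟨hvU γ hγ x hx, rfl⟩) (fun c hcγ => ⟨hcU γ hγ c hcγ, ?_⟩)
    · rintro _ b _ b' ⟨hb, rfl⟩ ⟨hb', rfl⟩ hle
      exact le_of_not_gt fun hgt => (hlt _ hb' _ hb hgt).not_ge hle
    · rintro _ b _ b' ⟨hb, rfl⟩ ⟨hb', rfl⟩ hle
      refine Or.inl (lt_of_not_ge fun hge => ?_)
      rcases hge.eq_or_lt with rfl | hgt
      · exact hle.false
      · exact (hlt _ hb' _ hb hgt).not_gt hle
    -- With the hypothesis on constants the relation is the graph of `f`, so premises keep the value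
    -- 1 as well.
    · by_cases hct : k' c = top'
      · rw [hct, hft]; exact hc γ hγ c hcγ hct
      · exact (hcst γ hγ c hcγ hct).symm
  obtain ⟨hU, h1⟩ := key φ (Set.mem_insert _ _)
  have h2 := hlttop _ hU hφ
  rw [← h1, h (f ∘ v) fun γ hγ => by
    rw [(key γ (Set.mem_insert_of_mem _ hγ)).2, hv γ hγ, hft]] at h2
  exact h2.false

theorem Logic.admissible_of_entails {L : Logic UnitRat} {Γ : Set (Fm UnitRat)}
    {φ : Fm UnitRat} (h : L.Entails Γ φ) : L.Admissible Γ φ := fun σ hσ =>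
  L.cut (by rintro _ ⟨γ, hγ, rfl⟩; exact hσ γ hγ) (L.substitution σ h)

/-- The canonical chain has exactly the theorems of `L` as its valid formulas, so a rule valid in it
preserves theoremhood of instances; the other direction is the substitution by representing
formulas. -/
theorem IsCanonical.admissible_iff (hL : L.IsExtensionOf RG) (hA : IsCanonical L bot top k t)
    {Γ : Set (Fm UnitRat)} {φ : Fm UnitRat} :
    L.Admissible Γ φ ↔ ChainValid bot top k Γ φ := by
  refine ⟨hA.chainValid_of_admissible hL, fun h σ hσ =>
    hA.isTheorem_of_chainValid hL fun w _ => ?_⟩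
  rw [cev_subst]
  refine h _ fun γ hγ => ?_
  rw [← cev_subst]
  exact hA.chainValid_of_admissible hL (Logic.admissible_of_entails (hσ γ hγ)) w (by simp)

theorem cev_sup_eq_top (h : RGChain X bot top k) {w : ℕ → X} {α β : Fm UnitRat} :
    cev bot top k w (.sup α β) = top ↔ cev bot top k w α = top ∨ cev bot top k w β = top := by
  change max (cev bot top k w α) (cev bot top k w β) = top ↔ _
  constructor
  · intro hm
    rcases max_choice (cev bot top k w α) (cev bot top k w β) with h1 | h1
    · exact Or.inl (h1.symm.trans hm)
    · exact Or.inr (h1.symm.trans hm)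
  · rintro (h1 | h1)
    · rw [h1]; exact max_eq_left (h.le_top _)
    · rw [h1]; exact max_eq_right (h.le_top _)

/-- An actively structurally complete extension is the logic of its canonical chain. -/
theorem IsCanonical.entails_iff_of_ASC (hL : L.IsExtensionOf RG)
    (hA : IsCanonical L bot top k t) (hASC : L.ASC) {Γ : Set (Fm UnitRat)} (hΓ : Γ.Finite)
    {φ : Fm UnitRat} : L.Entails Γ φ ↔ ChainValid bot top k Γ φ := by
  refine ⟨fun h => hA.chainValid_of_admissible hL (Logic.admissible_of_entails h), fun h => ?_⟩
  -- Shifting the variables frees `x_0` for use as the disjunct.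
  let s : ℕ → Fm UnitRat := fun n => .var (n + 1)
  let Γ' : Set (Fm UnitRat) := (fun γ => .sup (γ.subst s) (.var 0)) '' Γ
  have hΓ' : L.Entails Γ' (.sup (φ.subst s) (.var 0)) := by
    -- The weakened rule is active, as `x_0` may become 1, and it inherits validity in the canonical
    -- chain because 1 is join-prime in a chain.
    refine hASC _ _ (hΓ.image _) ⟨fun _ => .one, ?_⟩ ((hA.admissible_iff hL).2 fun v hv => ?_)
    · rintro _ ⟨γ, hγ, rfl⟩
      refine hA.isTheorem_of_chainValid hL fun w _ => ?_
      exact (cev_sup_eq_top hA.chain).2 (Or.inr rfl)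
    · rw [cev_sup_eq_top hA.chain]
      by_contra! hno
      refine hno.1 ?_
      rw [cev_subst]
      refine h _ fun γ hγ => ?_
      rw [← cev_subst]
      exact ((cev_sup_eq_top hA.chain).1 (hv _ ⟨γ, hγ, rfl⟩)).resolve_right hno.2
  -- Undoes the shift and puts `φ` for `x_0`: each new premise follows from an old one, and the
  -- conclusion becomes `φ ∨ φ`.
  let r : ℕ → Fm UnitRat := fun n => Nat.casesOn n φ .var
  have hrs : ∀ ψ : Fm UnitRat, (ψ.subst s).subst r = ψ := by
    intro ψ
    induction ψ <;> simp_all [Tm.subst, s, r]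
  have hsub : L.Entails (Tm.subst r '' Γ') (.sup ((φ.subst s).subst r) φ) :=
    L.substitution r hΓ'
  rw [hrs] at hsub
  have hφ : L.Entails Γ (.sup φ φ) := by
    refine L.cut ?_ hsub
    rintro _ ⟨_, ⟨γ, hγ, rfl⟩, rfl⟩
    refine L.cut (Δ := {γ}) (by rintro _ rfl; exact L.reflexive hγ) (hL _ _ ?_)
    refine RG_entails (Set.finite_singleton _) fun A hA v hv => ?_
    change A.sup (((γ.subst s).subst r).eval A v) _ = A.one
    rw [hrs, hv γ rfl, GA_sup_comm hA.1]
    have := GA_sup_absorb hA.1 (φ.eval A v) A.one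
    rwa [GA_inf_one hA.1] at this
  refine L.cut (Δ := {.sup φ φ}) (by rintro _ rfl; exact hφ) (hL _ _ ?_)
  refine RG_entails (Set.finite_singleton _) fun A hA v hv => ?_
  have h1 : A.sup (φ.eval A v) (φ.eval A v) = A.one := hv _ rfl
  have h2 := GA_sup_absorb hA.1 (φ.eval A v) (φ.eval A v)
  rw [GA_inf_self hA.1] at h2
  exact h2.symm.trans h1

/-- Extensions of the logic of a chain are structurally complete. -/
theorem IsCanonical.entails_of_chainValid {L₀ : Logic UnitRat} (hL₀ : L₀.IsExtensionOf RG)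
    (hB : RGChain Y bot' top' k')
    (hY : ∀ (Γ : Set (Fm UnitRat)) (φ : Fm UnitRat), Γ.Finite →
      (L₀.Entails Γ φ ↔ ChainValid bot' top' k' Γ φ))
    (hL : L.IsExtensionOf L₀) (hA : IsCanonical L bot top k t) {Γ : Set (Fm UnitRat)}
    (hΓ : Γ.Finite) {φ : Fm UnitRat} (h : ChainValid bot top k Γ φ) : L.Entails Γ φ := by
  classical
  have hLRG : L.IsExtensionOf RG := fun Γ φ h => hL _ _ (hL₀ _ _ h)
  by_contra hno
  have h0 : ¬ L.IsTheorem (.cst 0) := by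
    obtain ⟨Z, _, bz, tz, kz, hZ, hC, w, -, hw⟩ := exists_chain_of_not_entails hLRG hno
    exact fun hth => hZ.bot_ne_top hw (hZ.zero ▸ hC.cst hth)
  let F : Finset UnitRat := (insert 0 ((hΓ.insert φ).toFinset.biUnion
    fun γ => γ.csts.toFinset)).filter fun c => ¬ L.IsTheorem (.cst c)
  have h0F : 0 ∈ F := Finset.mem_filter.2 ⟨Finset.mem_insert_self _ _, h0⟩
  -- The greatest index, among 0 and the constants of the rule, whose constant is not a theorem of
  -- `L`.
  obtain ⟨q, hqF, hq⟩ := F.exists_max_image id ⟨0, h0F⟩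
  have hqth : ¬ L.IsTheorem (.cst q) := (Finset.mem_filter.1 hqF).2
  have hqY : k' q ≠ top' := fun he =>
    hqth (hL _ _ ((hY ∅ (.cst q) Set.finite_empty).2 fun _ _ => he))
  -- Since `c_q` is not 1 in `Y`, the rule from `c_q ∨ φ` to `φ` is valid there and so holds in `L`.
  -- This is where `L` must extend the logic of a chain: the rule can now be refuted in a chain in
  -- which `c_q` is not 1.
  have hno' : ¬ L.Entails Γ (.sup (.cst q) φ) := fun hen => by
    refine hno (L.cut (Δ := {.sup (.cst q) φ}) (by rintro _ rfl; exact hen) (hL _ _ ?_))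
    refine (hY _ _ (Set.finite_singleton _)).2 fun w hw => ?_
    exact ((cev_sup_eq_top hB).1 (hw _ rfl)).resolve_left hqY
  obtain ⟨Z, _, bz, tz, kz, hZ, hC, w, hw, hwφ⟩ := exists_chain_of_not_entails hLRG hno'
  rw [Ne, cev_sup_eq_top hZ, not_or] at hwφ
  refine hA.not_chainValid hZ hC hΓ hw hwφ.2 (fun γ hγ c hc hct => ?_) h
  rw [hA.cst_iff]
  by_contra hcth
  have hcq : c ≤ q := hq c (Finset.mem_filter.2 ⟨Finset.mem_insert_of_mem (Finset.mem_biUnion.2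
    ⟨γ, (hΓ.insert φ).mem_toFinset.2 hγ, List.mem_toFinset.2 hc⟩), hcth⟩)
  exact hwφ.1 (le_antisymm (hZ.le_top _) (hct ▸ hZ.mono hcq))

end rules

/-! ### Existence of the canonical chain -/

theorem isTheorem_cst_mono {L : Logic UnitRat} (hL : L.IsExtensionOf RG) {p q : UnitRat}
    (hpq : p ≤ q) (h : L.IsTheorem (.cst p)) : L.IsTheorem (.cst q) := by
  by_contra hno
  obtain ⟨X, _, bot, top, k, hX, hC, w, -, hw⟩ := exists_chain_of_not_entails hL hno
  exact hw (le_antisymm (hX.le_top _) (hC.cst h ▸ hX.mono hpq))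

theorem isTheorem_cst_one {L : Logic UnitRat} (hL : L.IsExtensionOf RG) :
    L.IsTheorem (.cst 1) :=
  hL _ _ (RG_isTheorem fun _ hA _ => hA.2.one)

/-! ### `Q_p^γ` as a rational Gödel chain -/

section Qp
variable {p : Set.Ico (0 : ℚ) 1} {γ : ℕ∞}

theorem QpCarrier.cases (a : QpCarrier p γ) : (∃ q, a = rat q) ∨ (∃ n, a = t n) ∨ a = ⊤ := by
  induction a using WithTop.recTopCoe with
  | top => exact Or.inr (Or.inr rfl)
  | coe a =>
    obtain ⟨s | s, rfl⟩ := toLex.surjective a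
    · exact Or.inl ⟨s, rfl⟩
    · exact Or.inr (Or.inl ⟨s, rfl⟩)

/-- The interpretation of the constants in `Q_p^γ`. -/
def qpCst (p : Set.Ico (0 : ℚ) 1) (γ : ℕ∞) (q : UnitRat) : QpCarrier p γ :=
  if h : (q : ℚ) ≤ p then QpCarrier.rat ⟨q, q.2.1, h⟩ else ⊤

theorem qpCst_of_le {q : UnitRat} (h : (q : ℚ) ≤ p) :
    qpCst p γ q = QpCarrier.rat ⟨q, q.2.1, h⟩ := dif_pos h

theorem qpCst_of_lt {q : UnitRat} (h : (p : ℚ) < q) : qpCst p γ q = ⊤ := dif_neg h.not_ge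

theorem qpCst_eq_top {q : UnitRat} : qpCst p γ q = ⊤ ↔ (p : ℚ) < q := by
  refine ⟨fun h => lt_of_not_ge fun hle => ?_, qpCst_of_lt⟩
  rw [qpCst_of_le hle] at h
  exact (QpCarrier.order.2.2.2.1 _).ne h

theorem Qp_rgChain :
    RGChain (QpCarrier p γ) (QpCarrier.rat ⟨0, le_rfl, p.2.1⟩) ⊤ (qpCst p γ) := by
  refine ⟨fun a => ?_, fun a => le_top, ?_, ?_, fun {q q'} hq => ?_, fun {q q'} hq hle => ?_⟩
  · rcases a.cases with ⟨q, rfl⟩ | ⟨n, rfl⟩ | rfl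
    · exact (QpCarrier.order.1 _ _).2 q.2.1
    · exact (QpCarrier.order.2.2.1 _ _).le
    · exact le_top
  · exact qpCst_of_le p.2.1
  · exact qpCst_of_lt p.2.2
  · rcases le_or_gt (q' : ℚ) p with h | h
    · have h' : (q : ℚ) ≤ p := le_trans hq h
      rw [qpCst_of_le h, qpCst_of_le h']
      have hq' : (q : ℚ) ≤ q' := hq
      exact (QpCarrier.order.1 _ _).2 hq'
    · rw [qpCst_of_lt h]
      exact le_top
  · by_contra hne
    have h' : (q : ℚ) ≤ p := le_of_not_gt fun h => hne (qpCst_of_lt h)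
    rw [qpCst_of_le h'] at hle
    rcases le_or_gt (q' : ℚ) p with h | h
    · rw [qpCst_of_le h] at hle
      have hle' : (q' : ℚ) ≤ q := ((QpCarrier.order (p := p) (γ := γ)).1
        ⟨q', q'.2.1, h⟩ ⟨q, q.2.1, h'⟩).1 hle
      exact hq.not_ge hle'
    · rw [qpCst_of_lt h] at hle
      exact (QpCarrier.order.2.2.2.1 _).not_ge hle

end Qp

/-- A downward closed property of natural numbers is membership in an ordinal `≤ ω`. -/
theorem exists_enat_lt_iff (P : ℕ → Prop) (hP : ∀ n m, n ≤ m → P m → P n) :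
    ∃ γ : ℕ∞, ∀ n : ℕ, (n : ℕ∞) < γ ↔ P n := by
  classical
  by_cases h : ∀ n, P n
  · exact ⟨⊤, fun n => ⟨fun _ => h n, fun _ => ENat.natCast_lt_top n⟩⟩
  · push Not at h
    refine ⟨(Nat.find h : ℕ), fun n => ?_⟩
    rw [Nat.cast_lt, Nat.lt_find_iff]
    constructor
    · intro hn
      exact not_not.1 (hn n le_rfl)
    · exact fun hn m hm => not_not.2 (hP m n hm hn)

/-! ### `Q_r` as a rational Gödel chain -/

section Qr
variable {r : Set.Ioc (0 : ℝ) 1}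

open Classical in
/-- The interpretation of the constants in `Q_r`. -/
noncomputable def qrCst (r : Set.Ioc (0 : ℝ) 1) (q : UnitRat) : QrCarrier r :=
  if h : ((q : ℚ) : ℝ) < r then ⟨q, Or.inl ⟨q.2.1, h⟩⟩ else ⟨1, Or.inr rfl⟩

theorem qrCst_of_lt {q : UnitRat} (h : ((q : ℚ) : ℝ) < r) :
    qrCst r q = ⟨q, Or.inl ⟨q.2.1, h⟩⟩ := dif_pos h

theorem qrCst_of_le {q : UnitRat} (h : (r : ℝ) ≤ (q : ℚ)) :
    qrCst r q = ⟨1, Or.inr rfl⟩ := dif_neg h.not_gt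

theorem Qr_lt_one {q : ℚ} (h : (q : ℝ) < r) : q < 1 := by
  exact_mod_cast h.trans_le r.2.2

theorem qrCst_eq_top {q : UnitRat} : qrCst r q = ⟨1, Or.inr rfl⟩ ↔ (r : ℝ) ≤ (q : ℚ) := by
  refine ⟨fun h => le_of_not_gt fun hlt => ?_, qrCst_of_le⟩
  rw [qrCst_of_lt hlt] at h
  exact (Qr_lt_one hlt).ne (congrArg Subtype.val h)

theorem QrCarrier.le_one (a : QrCarrier r) : (a : ℚ) ≤ 1 := by
  obtain ⟨q, ⟨_, h⟩ | rfl⟩ := a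
  · exact (Qr_lt_one h).le
  · exact le_rfl

theorem QrCarrier.nonneg (a : QrCarrier r) : 0 ≤ (a : ℚ) := by
  obtain ⟨q, ⟨h, _⟩ | rfl⟩ := a
  · exact h
  · exact zero_le_one

theorem Qr_rgChain : RGChain (QrCarrier r) ⟨0, Or.inl ⟨le_rfl, by exact_mod_cast r.2.1⟩⟩
    ⟨1, Or.inr rfl⟩ (qrCst r) := by
  refine ⟨fun a => a.nonneg, fun a => a.le_one, ?_, ?_, fun {q q'} hq => ?_,
    fun {q q'} hq hle => ?_⟩
  · exact qrCst_of_lt (q := 0) (by simpa using r.2.1)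
  · exact qrCst_of_le (q := 1) (by simpa using r.2.2)
  · rcases lt_or_ge ((q' : ℚ) : ℝ) r with h | h
    · have h' : ((q : ℚ) : ℝ) < r := lt_of_le_of_lt (by exact_mod_cast hq) h
      rw [qrCst_of_lt h, qrCst_of_lt h']
      exact hq
    · rw [qrCst_of_le h]
      exact QrCarrier.le_one _
  · by_contra hne
    have h' : ((q : ℚ) : ℝ) < r := lt_of_not_ge fun h => hne (qrCst_of_le h)
    rw [qrCst_of_lt h'] at hle
    rcases lt_or_ge ((q' : ℚ) : ℝ) r with h | h
    · rw [qrCst_of_lt h] at hle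
      exact hq.not_ge hle
    · rw [qrCst_of_le h] at hle
      exact (Qr_lt_one h').not_ge hle

end Qr

/-- Every extension of rational Gödel logic has a canonical chain. -/
theorem exists_isCanonical {L : Logic UnitRat} (hL : L.IsExtensionOf RG) :
    ∃ (X : Type) (_ : LinearOrder X) (bot top : X) (k : UnitRat → X) (t : ℕ → X),
      IsCanonical L bot top k t ∧ ((godelChain X bot top k).IsTrivial ∨
        (∃ r, godelChain X bot top k = Qr r) ∨ ∃ p γ, godelChain X bot top k = Qp p γ) := by
  classical
  by_cases h0 : L.IsTheorem (.cst 0)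
  · have hall : ∀ q : UnitRat, L.IsTheorem (.cst q) := fun q => isTheorem_cst_mono hL q.2.1 h0
    refine ⟨Unit, inferInstance, (), (), fun _ => (), fun _ => (),
      ⟨⟨fun _ => le_rfl, fun _ => le_rfl, rfl, rfl, fun _ => le_rfl, fun _ _ => rfl⟩,
        fun q => ⟨fun _ => hall q, fun _ => rfl⟩, fun _ => Or.inl ⟨0, rfl⟩,
        fun hp => absurd (hall _) hp.1, fun hp => absurd (hall _) hp.1,
        fun hp => absurd (hall _) hp.1⟩, Or.inl ?_⟩
    exact (inferInstance : Subsingleton Unit)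
  by_cases hmax : ∃ p, IsMaxConst L p
  · obtain ⟨p, hp⟩ := hmax
    have hp1 : (p : ℚ) < 1 := lt_of_le_of_ne p.2.2 fun h => hp.1 (by
      rw [show p = 1 from Subtype.ext h]; exact isTheorem_cst_one hL)
    -- The ordinal `γ` is the number of extra elements that the theorems of `L` permit above `c_p`.
    obtain ⟨γ, hγ⟩ := exists_enat_lt_iff (fun n => ¬ L.IsTheorem (chainFm p n))
      fun n m hnm hm hn => hm (isTheorem_chainFm_mono hL hnm hn)
    let p' : Set.Ico (0 : ℚ) 1 := ⟨p, p.2.1, hp1⟩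
    let t : ℕ → QpCarrier p' γ := fun n =>
      if h : (n : ℕ∞) < γ then QpCarrier.t ⟨n, h⟩ else ⊤
    have ht : ∀ {q n}, IsMaxConst L q → ¬ L.IsTheorem (chainFm q n) →
        ∃ h : (n : ℕ∞) < γ, t n = QpCarrier.t ⟨n, h⟩ := by
      intro q n hq hn
      obtain rfl := hq.unique hp
      exact ⟨(hγ n).2 hn, dif_pos ((hγ n).2 hn)⟩
    refine ⟨QpCarrier p' γ, inferInstance, _, ⊤, qpCst p' γ, t, ⟨Qp_rgChain, fun q => ?_,
      fun a => ?_, fun hq hn => ?_, fun {q n} hq hn => ?_, fun {q n m} hq hnm hm => ?_⟩,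
      Or.inr (Or.inr ⟨p', γ, rfl⟩)⟩
    · rw [qpCst_eq_top]
      refine ⟨fun h => ?_, fun h => lt_of_not_ge fun hle => hp.1 (isTheorem_cst_mono hL hle h)⟩
      by_contra hno
      exact (hp.2 q hno).not_gt h
    · rcases a.cases with ⟨q, rfl⟩ | ⟨n, rfl⟩ | rfl
      · have hq : (q : ℚ) ≤ p' := q.2.2
        exact Or.inl ⟨⟨q, q.2.1, hq.trans hp1.le⟩,
          (qpCst_of_le (p := p') (γ := γ) (q := ⟨q, q.2.1, hq.trans hp1.le⟩) hq).symm⟩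
      · have hn : t n = QpCarrier.t n := dif_pos n.2
        exact Or.inr ⟨p, n, hp, (hγ n).1 n.2, hn.symm⟩
      · exact Or.inl ⟨1, Qp_rgChain.one.symm⟩
    · obtain ⟨h, he⟩ := ht hq hn
      rw [he]
      exact QpCarrier.order.2.2.2.2 _
    · obtain ⟨h, he⟩ := ht hq hn
      obtain rfl := hq.unique hp
      have hpp : (q : ℚ) ≤ p' := le_refl (q : ℚ)
      rw [he, qpCst_of_le hpp]
      exact QpCarrier.order.2.2.1 _ _
    · obtain ⟨h, he⟩ := ht hq hm
      obtain ⟨h', he'⟩ := ht hq fun hn => hm (isTheorem_chainFm_mono hL hnm.le hn)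
      rw [he, he']
      exact lt_of_not_ge fun hle => hnm.not_ge ((QpCarrier.order.2.1 _ _).1 hle)
  · have hnomax : ∀ q : UnitRat, ¬ L.IsTheorem (.cst q) →
        ∃ q', ¬ L.IsTheorem (.cst q') ∧ q < q' := by
      intro q hq
      by_contra! hno
      exact hmax ⟨q, hq, hno⟩
    -- The supremum of `S` serves as `r`. It is not attained, as there is no greatest non-theorem,
    -- so `q < r` says precisely that `c_q` is not a theorem.
    let S : Set ℝ := {x | ∃ q : UnitRat, ¬ L.IsTheorem (.cst q) ∧ x = (q : ℚ)}
    have hbdd : ∀ x ∈ S, x ≤ 1 := by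
      rintro _ ⟨q, -, rfl⟩
      exact_mod_cast q.2.2
    have hS : BddAbove S := ⟨1, hbdd⟩
    have hne : S.Nonempty := ⟨_, 0, h0, rfl⟩
    have hlt : ∀ q : UnitRat, ((q : ℚ) : ℝ) < sSup S ↔ ¬ L.IsTheorem (.cst q) := by
      intro q
      constructor
      · intro h hth
        obtain ⟨_, ⟨q', hq', rfl⟩, hlt⟩ := exists_lt_of_lt_csSup hne h
        exact hq' (isTheorem_cst_mono hL (le_of_lt (by exact_mod_cast hlt)) hth)
      · intro h
        obtain ⟨q', hq', hlt⟩ := hnomax q h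
        exact lt_of_lt_of_le (by exact_mod_cast hlt) (le_csSup hS ⟨q', hq', rfl⟩)
    let r : Set.Ioc (0 : ℝ) 1 :=
      ⟨sSup S, by simpa using (hlt 0).2 h0, csSup_le hne hbdd⟩
    refine ⟨QrCarrier r, inferInstance, _, ⟨1, Or.inr rfl⟩, qrCst r, fun _ => ⟨1, Or.inr rfl⟩,
      ⟨Qr_rgChain, fun q => ?_, fun a => ?_, fun hp => absurd ⟨_, hp⟩ hmax,
        fun hp => absurd ⟨_, hp⟩ hmax, fun hp => absurd ⟨_, hp⟩ hmax⟩, Or.inr (Or.inl ⟨r, rfl⟩)⟩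
    · rw [qrCst_eq_top, ← not_lt, hlt, not_not]
    · obtain ⟨q, ⟨h, h'⟩ | rfl⟩ := a
      · exact Or.inl ⟨⟨q, h, (Qr_lt_one h').le⟩,
          (qrCst_of_lt (r := r) (q := ⟨q, h, (Qr_lt_one h').le⟩) h').symm⟩
      · exact Or.inl ⟨1, Qr_rgChain.one.symm⟩

/-! ### Algebraization -/

theorem quasivarietyGen_singleton {C : Type} (A : Alg C) :
    quasivarietyGen {A} = {B | ∀ q, A.ValidatesQ q → B.ValidatesQ q} := by
  ext B
  constructor
  · intro h q hq
    exact h {B | B.ValidatesQ q} ⟨⟨{q}, by simp⟩, by simpa using hq⟩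
  · rintro h K ⟨⟨E, rfl⟩, hK⟩ q hq
    exact h q (hK rfl q hq)

theorem mem_quasivarietyGen_singleton {C : Type} (A : Alg C) : A ∈ quasivarietyGen {A} := by
  rw [quasivarietyGen_singleton]
  exact fun _ h => h

theorem isQuasivariety_quasivarietyGen_singleton {C : Type} (A : Alg C) :
    IsQuasivariety (quasivarietyGen {A}) :=
  ⟨{q | A.ValidatesQ q}, quasivarietyGen_singleton A⟩

/-- In the algebras of the equivalent algebraic semantics of an extension of rational Gödel
logic, the truth set consists of `1`. -/
theorem solves_applyEqs_iff {L : Logic UnitRat} (hL : L.IsExtensionOf RG)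
    {K : Set (Alg UnitRat)} {τ : Set (Equation UnitRat Unit)} {Δ : Set (Tm UnitRat (Fin 2))}
    (hent : ∀ (Γ : Set (Fm UnitRat)) (φ : Fm UnitRat), L.Entails Γ φ ↔
      ∀ e ∈ applyEqs τ φ, EqConsequence K (⋃ γ ∈ Γ, applyEqs τ γ) e)
    (hΔ : ∀ e ∈ ⋃ δ ∈ applyFms Δ (.var 0) (.var 1), applyEqs τ δ,
      EqConsequence K {(.var 0, .var 1)} e)
    (hΔ' : EqConsequence K (⋃ δ ∈ applyFms Δ (.var 0) (.var 1), applyEqs τ δ) (.var 0, .var 1))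
    {B : Alg UnitRat} (hB : B ∈ K) (v : ℕ → B.carrier) (φ : Fm UnitRat) :
    (∀ e ∈ applyEqs τ φ, B.Solves v e) ↔ φ.eval B v = B.one := by
  have hone : ∀ e ∈ applyEqs τ (.one : Fm UnitRat), ∀ v : ℕ → B.carrier, B.Solves v e :=
    fun e he v => (hent ∅ .one).1 (hL _ _ (RG_isTheorem fun _ _ _ => rfl)) e he B hB v (by simp)
  have happ : ∀ {α β : Fm UnitRat} {v w : ℕ → B.carrier}, α.eval B v = β.eval B w →
      (∀ e ∈ applyEqs τ α, B.Solves v e) → ∀ e ∈ applyEqs τ β, B.Solves w e := by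
    rintro α β v w h hα _ ⟨e, he, rfl⟩
    have := hα _ ⟨e, he, rfl⟩
    simp only [Alg.Solves, Tm.eval_subst] at this ⊢
    rwa [h] at this
  refine ⟨fun h => ?_, fun h => ?_⟩
  -- From `x` one derives `Δ(x, 1)`: the members of `Δ(x, x)` are theorems of `L`, and they agree
  -- with those of `Δ(x, 1)` when `x` has value 1. Hence a solution of `τ(φ)` solves `τ(Δ(φ, 1))`,
  -- which forces `φ = 1`.
  · have hx : ∀ d : Tm UnitRat (Fin 2), d ∈ Δ →
        L.Entails {.var 0} (d.subst ![.var 0, .one]) := by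
      intro d hd
      refine L.cut (Δ := {.var 0, d.subst ![.var 0, .var 0]}) ?_ (hL _ _ (RG_entails
        (by simp) fun A hA w hw => ?_))
      · rintro _ (rfl | rfl)
        · exact L.reflexive rfl
        · refine (hent _ _).2 ?_
          rintro _ ⟨e, he, rfl⟩ A hA w -
          have := hΔ _ (Set.mem_biUnion ⟨d, hd, rfl⟩ ⟨e, he, rfl⟩) A hA (fun _ => w 0)
            (by rintro _ rfl; rfl)
          simp only [Alg.Solves, Tm.eval_subst] at this ⊢
          have hw : (fun i => (![.var 0, .var 0] i : Fm UnitRat).eval A w) =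
              fun i => (![.var 0, .var 1] i : Fm UnitRat).eval A fun _ => w 0 := by
            funext i
            fin_cases i <;> rfl
          rwa [hw]
      · have h0 : w 0 = A.one := hw (.var 0) (by simp)
        have h1 := hw (d.subst ![.var 0, .var 0]) (by simp)
        rw [Tm.eval_subst] at h1 ⊢
        rw [← h1]
        congr 1
        funext i
        fin_cases i
        · rfl
        · exact h0.symm
    have := hΔ' B hB (fun n => Nat.casesOn n (φ.eval B v) fun _ => B.one) (by
      intro e he
      obtain ⟨_, ⟨d, hd, rfl⟩, he⟩ := Set.mem_iUnion₂.1 he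
      have h1 := fun e he => (hent _ _).1 (hx d hd) e he B hB (fun _ => φ.eval B v) (by
        intro e' he'
        simp only [Set.mem_singleton_iff, Set.iUnion_iUnion_eq_left] at he'
        exact happ (α := φ) (β := .var 0) (v := v) rfl h e' he')
      refine happ ?_ h1 e he
      rw [Tm.eval_subst, Tm.eval_subst]
      congr 1
      funext i
      fin_cases i <;> rfl)
    exact this
  · exact happ (α := .one) (v := v) h.symm (fun e he => hone e he v)

/-- The formula `(s → t) ∧ (t → s)` that expresses the equation `s ≈ t`. -/
def eqFm (e : Equation UnitRat ℕ) : Fm UnitRat := .inf (.imp e.1 e.2) (.imp e.2 e.1)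

theorem GA_inf_eq_one {C : Type} {A : Alg C} (hA : A.reduct ∈ GA) {a b : A.carrier} :
    A.inf a b = A.one ↔ a = A.one ∧ b = A.one := by
  have key : ∀ {a b}, A.inf a b = A.one → a = A.one := fun {a b} h => by
    rw [← GA_inf_one hA a, ← h, ← GA_inf_assoc hA, GA_inf_self hA]
  refine ⟨fun h => ⟨key h, key ((GA_inf_comm hA b a).trans h)⟩, ?_⟩
  rintro ⟨rfl, rfl⟩
  exact GA_inf_self hA _

theorem eqFm_eval {A : Alg UnitRat} (hA : A ∈ RGA) (v : ℕ → A.carrier) (e : Equation UnitRat ℕ) :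
    (eqFm e).eval A v = A.one ↔ A.Solves v e := by
  change A.inf (A.imp _ _) (A.imp _ _) = A.one ↔ e.1.eval A v = e.2.eval A v
  rw [GA_inf_eq_one hA.1, GA_imp_eq_one_iff hA.1, GA_imp_eq_one_iff hA.1]
  refine ⟨fun ⟨h1, h2⟩ => ?_, fun h => ?_⟩
  · rw [← h1, GA_inf_comm hA.1, h2]
  · rw [h]
    exact ⟨GA_inf_self hA.1 _, GA_inf_self hA.1 _⟩

/-! ### The logic of a chain and the quasivariety generated by the chain -/

section final
variable {L : Logic UnitRat} {X Y : Type} [LinearOrder X] [LinearOrder Y] {bot top : X}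
  {k : UnitRat → X} {bot' top' : Y} {k' : UnitRat → Y}

theorem RGChain.validatesQ_iff (h : RGChain X bot top k) (q : QuasiEquation UnitRat) :
    (godelChain X bot top k).ValidatesQ q ↔
      ChainValid bot top k (eqFm '' q.premises) (eqFm q.conclusion) := by
  have hA := h.isChainRGA.1
  constructor
  · intro hq v hv
    exact (eqFm_eval hA v _).2 (hq v fun e he => (eqFm_eval hA v e).1 (hv _ ⟨e, he, rfl⟩))
  · intro hq v hv
    refine (eqFm_eval hA v _).1 (hq v ?_)
    rintro _ ⟨e, he, rfl⟩
    exact (eqFm_eval hA v e).2 (hv e he)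

theorem quasivarietyGen_eq_of_chainValid_iff (h : RGChain X bot top k)
    (h' : RGChain Y bot' top' k') (hiff : ∀ (Γ : Set (Fm UnitRat)) (φ : Fm UnitRat), Γ.Finite →
      (ChainValid bot top k Γ φ ↔ ChainValid bot' top' k' Γ φ)) :
    quasivarietyGen {godelChain X bot top k} = quasivarietyGen {godelChain Y bot' top' k'} := by
  have : ∀ q, (godelChain X bot top k).ValidatesQ q ↔ (godelChain Y bot' top' k').ValidatesQ q :=
    fun q => by
      rw [h.validatesQ_iff, h'.validatesQ_iff, hiff _ _ (q.finite_premises.image _)]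
  simp only [quasivarietyGen_singleton, this]

/-- A logic algebraized by the quasivariety generated by a chain is the logic of the chain. -/
theorem entails_iff_of_algebraizedBy (hL : L.IsExtensionOf RG)
    (hK : L.AlgebraizedBy (quasivarietyGen {godelChain X bot top k})) (Γ : Set (Fm UnitRat))
    (φ : Fm UnitRat) (hΓ : Γ.Finite) : L.Entails Γ φ ↔ ChainValid bot top k Γ φ := by
  obtain ⟨-, τ, Δ, -, -, hent, hΔ, hΔ'⟩ := hK
  have key := fun {B} (hB : B ∈ _) => solves_applyEqs_iff hL hent hΔ hΔ' hB
  rw [hent]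
  constructor
  · intro h v hv
    have hmem := mem_quasivarietyGen_singleton (godelChain X bot top k)
    refine (key hmem v φ).1 fun e he => h e he _ hmem v fun d hd => ?_
    obtain ⟨γ, hγ, hd⟩ := Set.mem_iUnion₂.1 hd
    exact (key hmem v γ).2 (hv γ hγ) d hd
  · intro h e he B hB v hv
    refine (key hB v φ).2 ?_ e he
    rw [quasivarietyGen_singleton] at hB
    refine hB ⟨eqOne '' Γ, hΓ.image _, eqOne φ⟩ (fun w hw => ?_) v ?_
    · exact h w fun γ hγ => hw _ ⟨γ, hγ, rfl⟩
    · rintro _ ⟨γ, hγ, rfl⟩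
      rw [← quasivarietyGen_singleton] at hB
      exact (key hB v γ).1 fun e he => hv e (Set.mem_iUnion₂.2 ⟨γ, hγ, he⟩)

/-- The logic of a chain is algebraized by the quasivariety generated by the chain. -/
theorem algebraizedBy_of_entails_iff (hL : L.IsExtensionOf RG) (hX : RGChain X bot top k)
    (hiff : ∀ (Γ : Set (Fm UnitRat)) (φ : Fm UnitRat), Γ.Finite →
      (L.Entails Γ φ ↔ ChainValid bot top k Γ φ)) :
    L.AlgebraizedBy (quasivarietyGen {godelChain X bot top k}) := by
  have hA := hX.isChainRGA.1
  let τ : Set (Equation UnitRat Unit) := {(.var (), .one)}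
  let Δ : Set (Tm UnitRat (Fin 2)) := {.imp (.var 0) (.var 1), .imp (.var 1) (.var 0)}
  have hτ : ∀ φ : Fm UnitRat, applyEqs τ φ = {eqOne φ} := by
    intro φ
    ext e
    constructor
    · rintro ⟨t, rfl, rfl⟩
      rfl
    · rintro rfl
      exact ⟨_, rfl, rfl⟩
  have hfms : applyFms Δ (.var 0 : Fm UnitRat) (.var 1) =
      {.imp (.var 0) (.var 1), .imp (.var 1) (.var 0)} := by
    ext χ
    constructor
    · rintro ⟨d, rfl | rfl, rfl⟩
      · exact Or.inl rfl
      · exact Or.inr rfl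
    · rintro (rfl | rfl)
      · exact ⟨_, Or.inl rfl, rfl⟩
      · exact ⟨_, Or.inr rfl, rfl⟩
  refine ⟨isQuasivariety_quasivarietyGen_singleton _, τ, Δ, Set.finite_singleton _, by simp [Δ],
    fun Γ φ => ?_, ?_, ?_⟩
  · simp only [hτ, Set.mem_singleton_iff, forall_eq]
    constructor
    · intro h B hB v hv
      obtain ⟨Γ₀, hsub, hfin, hent⟩ := L.finitary h
      rw [quasivarietyGen_singleton] at hB
      refine hB ⟨eqOne '' Γ₀, hfin.image _, eqOne φ⟩ (fun w hw => ?_) v ?_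
      · exact (hiff _ _ hfin).1 hent w fun γ hγ => hw _ ⟨γ, hγ, rfl⟩
      · rintro _ ⟨γ, hγ, rfl⟩
        exact hv _ (Set.mem_iUnion₂.2 ⟨γ, hsub hγ, rfl⟩)
    · intro h
      have hT := isTheory_consequences hL Γ
      have hRGA := lind_mem_RGA hT
      -- A quasiequation valid in the chain is a derivable rule of `L` under the translation `eqFm`,
      -- and the theory of `L`-consequences of `Γ` is closed under all instances of such rules.
      have hmem : lind hT ∈ quasivarietyGen {godelChain X bot top k} := by
        rw [quasivarietyGen_singleton]
        intro q hq v hv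
        obtain ⟨σ, rfl⟩ := exists_lindMk_comp hT v
        rw [hX.validatesQ_iff, ← hiff _ _ (q.finite_premises.image _)] at hq
        rw [← eqFm_eval hRGA, lind_eval, lindMk_eq_one]
        refine L.cut ?_ (L.substitution σ hq)
        rintro _ ⟨_, ⟨e, he, rfl⟩, rfl⟩
        have := hv e he
        rwa [← eqFm_eval hRGA, lind_eval, lindMk_eq_one] at this
      have hev : ∀ ψ : Fm UnitRat,
          (lind hT).Solves (fun n => lindMk hT (.var n)) (eqOne ψ) ↔ L.Entails Γ ψ := by
        intro ψ
        change ψ.eval (lind hT) _ = (lind hT).one ↔ _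
        rw [lind_eval, lindMk_eq_one, Tm.subst_var]
        rfl
      refine (hev φ).1 (h _ hmem _ fun d hd => ?_)
      obtain ⟨γ, hγ, rfl⟩ := Set.mem_iUnion₂.1 hd
      exact (hev γ).2 (L.reflexive hγ)
  · rw [hfms]
    intro e he B hB v hv
    rw [quasivarietyGen_singleton] at hB
    refine hB ⟨{(.var 0, .var 1)}, Set.finite_singleton _, e⟩ (fun w hw => ?_) v hv
    have h01 : w 0 = w 1 := hw _ rfl
    simp only [hτ, Set.mem_iUnion] at he
    obtain ⟨δ, rfl | rfl, rfl⟩ := he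
    · change (godelChain X bot top k).imp (w 0) (w 1) = (godelChain X bot top k).one
      rw [h01, GA_imp_self hA.1]
    · change (godelChain X bot top k).imp (w 1) (w 0) = (godelChain X bot top k).one
      rw [h01, GA_imp_self hA.1]
  · rw [hfms]
    intro B hB v hv
    rw [quasivarietyGen_singleton] at hB
    refine hB ⟨{eqOne (.imp (.var 0) (.var 1)), eqOne (.imp (.var 1) (.var 0))}, by simp,
      (.var 0, .var 1)⟩ (fun w hw => ?_) v ?_
    · refine (eqFm_eval hA w _).1 ((GA_inf_eq_one hA.1).2 ⟨?_, ?_⟩)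
      · exact hw _ (Or.inl rfl)
      · exact hw _ (Or.inr rfl)
    · rintro e (rfl | rfl)
      · exact hv _ (Set.mem_iUnion₂.2 ⟨_, Or.inl rfl, by rw [hτ]; rfl⟩)
      · exact hv _ (Set.mem_iUnion₂.2 ⟨_, Or.inr rfl, by rw [hτ]; rfl⟩)

/-- Extensions of the logic of a chain are structurally complete. -/
theorem HSC_of_entails_iff (hL : L.IsExtensionOf RG) (hX : RGChain X bot top k)
    (hiff : ∀ (Γ : Set (Fm UnitRat)) (φ : Fm UnitRat), Γ.Finite →
      (L.Entails Γ φ ↔ ChainValid bot top k Γ φ)) : L.HSC := by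
  intro L' hL' Γ φ hΓ hadm
  have hRG : L'.IsExtensionOf RG := fun Γ φ h => hL' _ _ (hL _ _ h)
  obtain ⟨Y, _, bot', top', k', t, hA, -⟩ := exists_isCanonical hRG
  exact hA.entails_of_chainValid hL hX hiff hL' hΓ (hA.chainValid_of_admissible hRG hadm)

end final
end RatGodel

theorem theorem8p2 (L : RatGodel.Logic RatGodel.UnitRat)
    (hL : L.IsExtensionOf RatGodel.RG) :
    List.TFAE [
      L.HSC,
      L.SC,
      L.ASC,
      ∃ K : Set (RatGodel.Alg RatGodel.UnitRat), L.AlgebraizedBy K ∧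
        ∃ A, RatGodel.IsChainRGA A ∧ K = RatGodel.quasivarietyGen {A}] ∧
    ∀ K : Set (RatGodel.Alg RatGodel.UnitRat), L.AlgebraizedBy K →
      (∃ A, RatGodel.IsChainRGA A ∧ K = RatGodel.quasivarietyGen {A}) →
      ∃ A, RatGodel.IsChainRGA A ∧ K = RatGodel.quasivarietyGen {A} ∧
        (A.IsTrivial ∨
          (∃ r : Set.Ioc (0 : ℝ) 1, A = RatGodel.Qr r) ∨
          ∃ (p : Set.Ico (0 : ℚ) 1) (γ : ℕ∞), A = RatGodel.Qp p γ) := by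
  have h12 : L.HSC → L.SC := fun h => h L fun _ _ h => h
  have h23 : L.SC → L.ASC := fun h Γ φ hΓ _ hadm => h Γ φ hΓ hadm
  have h41 : (∃ K : Set (RatGodel.Alg RatGodel.UnitRat), L.AlgebraizedBy K ∧
      ∃ A, RatGodel.IsChainRGA A ∧ K = RatGodel.quasivarietyGen {A}) → L.HSC := by
    rintro ⟨_, hK, A, hA, rfl⟩
    obtain ⟨X, _, bot, top, k, hX, rfl⟩ := hA.exists_eq
    exact RatGodel.HSC_of_entails_iff hL hX (RatGodel.entails_iff_of_algebraizedBy hL hK)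
  obtain ⟨Y, _, bot', top', k', t, hY, hshape⟩ := RatGodel.exists_isCanonical hL
  refine ⟨?_, ?_⟩
  · tfae_have 1 → 2 := h12
    tfae_have 2 → 3 := h23
    tfae_have 3 → 4 := fun h => ⟨_, RatGodel.algebraizedBy_of_entails_iff hL hY.chain
      fun Γ φ hΓ => hY.entails_iff_of_ASC hL h hΓ, _, hY.chain.isChainRGA, rfl⟩
    tfae_have 4 → 1 := h41
    tfae_finish
  · rintro _ hK ⟨A, hA, rfl⟩
    -- Active structural completeness makes `L` the logic of its canonical chain; it is also the
    -- logic of the given generator, so the two chains have the same valid finite rules.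
    have hASC := h23 (h12 (h41 ⟨_, hK, A, hA, rfl⟩))
    obtain ⟨X, _, bot, top, k, hX, rfl⟩ := hA.exists_eq
    refine ⟨_, hY.chain.isChainRGA, RatGodel.quasivarietyGen_eq_of_chainValid_iff hX hY.chain
      fun Γ φ hΓ => ?_, hshape⟩
    rw [← RatGodel.entails_iff_of_algebraizedBy hL hK Γ φ hΓ, hY.entails_iff_of_ASC hL hASC hΓ]
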